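/- Let $n\ge 1$ and $\delta>0$. Let $\mathcal S\subset\mathbb R^{n+1}$ be a complete, properly immersed smooth hypersurface without boundary, i.e. the image $\mathcal S=F(M)$ of a proper smooth immersion $F:M\to\mathbb R^{n+1}$ of an $n$-dimensional manifold $M$. Say that $\mathcal S$ has *$\delta$-separated ends* if the following holds for all disjoint connected open subsets $\mathcal S_1,\mathcal S_2$ of $\mathcal S$ such that $\overline{\mathcal S_1}\cup\overline{\mathcal S_2}=\mathcal S$, $\partial\overline{\mathcal S_1}=\partial\overline{\mathcal S_2}$ and this common boundary is bounded (closures and boundaries taken in $\mathcal S$): for all sufficiently large $r$, either one of the sets $(\frac1r\mathcal S_i)\setminus B(0,1)$, $i=1,2$, is empty, or $$\inf\{\|x_1-x_2\| : x_i\in(\tfrac1r\mathcal S_i)\setminus B(0,1),\ i=1,2\}\ \ge\ \delta .$$ Say that $\mathcal S$ is a *self-shrinker* if $H=\frac{\langle x,\nu\rangle}{2}$ on $\mathcal S$, where $x$ is the position vector, $\nu$ a (local) unit normal field and $H=\operatorname{div}\nu$ the mean curvature; this equation does not depend on the choice of sign of $\nu$. Suppose that $\mathcal S$ has $\delta$-separated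 ends, that $\alpha:\mathbb S^{n-1}\to\mathcal S\subset\mathbb R^{n+1}$ is a smooth embedding such that $\mathcal S\setminus\alpha(\mathbb S^{n-1})$ has exactly two connected components (as a subset of $\mathbb R^{n+1}$), called $\mathcal S^+$ and $\mathcal S^-$, and that $A\subset\mathbb S^n$ is a set of non-zero $n$-dimensional Lebesgue measure such that for every orthonormal basis $(e_1,\dots,e_{n+1})$ of $\mathbb R^{n+1}$ with $e_{n+1}\in A$, the following three conditions hold in the coordinates determined by this basis: 1. there exist $x=(x_1,\dots,x_n,x_{n+1})\in\mathcal S^-$ and $y=(x_1,\dots,x_n,y_{n+1})\in\mathcal S^+$ with $y_{n+1}<x_{n+1}$; 2. there exists a neighborhood $\mathcal V$ of $\alpha(\mathbb S^{n-1})$ in the closure of $\mathcal S^-$ such that for every $a=(z_1,\dots,z_n,a_{n+1})\in\mathcal V$ there is a point $u=(z_1,\dots,z_n,u_{n+1})\in\mathcal S^-$ with $a_{n+1}>u_{n+1}$ for which there is no $v=(z_1,\dots,z_n,v_{n+1})\in\mathcal S^+$ with $a_{n+1}>v_{n+1}>u_{n+1}$; 3. if $z=(z_1,\dots,z_{n+1})\in\alpha(\mathbb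 S^{n-1})$ and $b=(z_1,\dots,z_n,b_{n+1})\in\mathcal S^-$ satisfy $b_{n+1}>z_{n+1}$, then there is $w=(z_1,\dots,z_n,w_{n+1})\in\mathcal S^+$ with $b_{n+1}>w_{n+1}>z_{n+1}$. Then $\mathcal S$ is not a self-shrinker. -/

import Mathlib

open Set Filter Topology Manifold MeasureTheory
open scoped ContDiff RealInnerProductSpace Pointwise

/-- The Euclidean space `ℝᵈ`. -/
abbrev Euc (d : ℕ) : Type := EuclideanSpace ℝ (Fin d)

section Immersions

variable {d k : ℕ} {M : Type*} [TopologicalSpace M] [ChartedSpace (Euc d) M]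

/-- A smooth immersion of a `d`-dimensional manifold (without boundary) into `ℝᵏ`:
a `C^∞` map whose differential is injective at every point. -/
def IsSmoothImmersion (F : M → Euc k) : Prop :=
  ContMDiff (𝓡 d) 𝓘(ℝ, Euc k) ∞ F ∧
    ∀ p : M, Function.Injective (mfderiv (𝓡 d) 𝓘(ℝ, Euc k) F p)

/-- The `i`-th partial derivative at `p` of a map into `ℝᵏ`, with respect to the standard basis
of the tangent space `T_p M = ℝᵈ`. -/
noncomputable def partialDeriv (F : M → Euc k) (p : M) (i : Fin d) : Euc k :=
  mfderiv (𝓡 d) 𝓘(ℝ, Euc k) F p (EuclideanSpace.single i (1 : ℝ) : Euc d)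

/-- The first fundamental form `g_ij = ⟨∂_i F, ∂_j F⟩` of `F` at `p`. -/
noncomputable def firstFundamentalForm (F : M → Euc k) (p : M) : Matrix (Fin d) (Fin d) ℝ :=
  Matrix.of fun i j => ⟪partialDeriv F p i, partialDeriv F p j⟫

/-- The divergence along the immersed submanifold `F` of a vector field `N` with values in `ℝᵏ`:
`div N = ∑_{i,j} g^{ij} ⟨∂_j N, ∂_i F⟩`, i.e. `∑_i ⟨D_{τ_i} N, τ_i⟩` for an orthonormal frame
`τ` of the tangent space. -/
noncomputable def surfaceDivergence (F N : M → Euc k) (p : M) : ℝ :=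
  ∑ i : Fin d, ∑ j : Fin d, (firstFundamentalForm (d := d) F p)⁻¹ i j * ⟪partialDeriv N p j, partialDeriv F p i⟫

/-- `ν` is a smooth field of unit vectors normal to `F`, on the subset `U` of `M`. -/
def IsUnitNormalOn (F ν : M → Euc k) (U : Set M) : Prop :=
  ContMDiffOn (𝓡 d) 𝓘(ℝ, Euc k) ∞ ν U ∧
    ∀ p ∈ U, ‖ν p‖ = 1 ∧ ∀ i : Fin d, ⟪partialDeriv F p i, ν p⟫ = 0

/-- The immersed hypersurface `F : M → ℝᵈ⁺¹` is a self-shrinker: `H = ⟨x, ν⟩ / 2`, where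
`H = div ν`. Both sides change sign with `ν`, so that the equation does not depend on the choice
of the unit normal, and it is required for every locally defined unit normal field (these exist
around every point, even when `M` is not orientable). -/
def IsSelfShrinker (F : M → Euc (d + 1)) : Prop :=
  ∀ (U : Set M) (ν : M → Euc (d + 1)), IsOpen U → IsUnitNormalOn (d := d) F ν U →
    ∀ p ∈ U, surfaceDivergence (d := d) F ν p = ⟪F p, ν p⟫ / 2

end Immersions

/-- `S ⊆ ℝᵏ` has `δ`-separated ends. Openness, connectedness, closures and boundaries are those
of the subspace `S`. The last inequality says that the infimum of the distances between the two
(nonempty) sets is at least `δ`. -/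
def HasSeparatedEnds {k : ℕ} (δ : ℝ) (S : Set (Euc k)) : Prop :=
  ∀ S₁ S₂ : Set S, IsOpen S₁ → IsOpen S₂ → IsConnected S₁ → IsConnected S₂ → Disjoint S₁ S₂ →
    closure S₁ ∪ closure S₂ = univ →
    frontier (closure S₁) = frontier (closure S₂) →
    Bornology.IsBounded (frontier (closure S₁)) →
    ∀ᶠ r : ℝ in atTop,
      (r⁻¹ • (Subtype.val '' S₁ : Set (Euc k))) \ Metric.ball 0 1 = ∅ ∨
      (r⁻¹ • (Subtype.val '' S₂ : Set (Euc k))) \ Metric.ball 0 1 = ∅ ∨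
      ∀ x₁ ∈ (r⁻¹ • (Subtype.val '' S₁ : Set (Euc k))) \ Metric.ball 0 1,
        ∀ x₂ ∈ (r⁻¹ • (Subtype.val '' S₂ : Set (Euc k))) \ Metric.ball 0 1, δ ≤ ‖x₁ - x₂‖

/-- The set of connected components of a subset `X` of a topological space. -/
def componentsOf {T : Type*} [TopologicalSpace T] (X : Set T) : Set (Set T) :=
  {C | ∃ x ∈ X, C = connectedComponentIn X x}

section Ordering

variable {n : ℕ}

/-- The last coordinate `x_{n+1}` of `x` in the orthonormal basis `b` of `ℝⁿ⁺¹`. -/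
noncomputable def height (b : OrthonormalBasis (Fin (n + 1)) ℝ (Euc (n + 1)))
    (x : Euc (n + 1)) : ℝ :=
  b.repr x (Fin.last n)

/-- `x` and `y` have the same first `n` coordinates in the orthonormal basis `b` of `ℝⁿ⁺¹`. -/
def SameVertical (b : OrthonormalBasis (Fin (n + 1)) ℝ (Euc (n + 1)))
    (x y : Euc (n + 1)) : Prop :=
  ∀ i : Fin n, b.repr x i.castSucc = b.repr y i.castSucc

/-- The three ordering conditions on the pieces `Sp` (for `𝒮⁺`) and `Sm` (for `𝒮⁻`) with common
boundary `Γ`, in the coordinates of the orthonormal basis `b`. -/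
structure GraphOrdering (b : OrthonormalBasis (Fin (n + 1)) ℝ (Euc (n + 1)))
    (Γ Sp Sm : Set (Euc (n + 1))) : Prop where
  /-- Some point of `𝒮⁻` lies above a point of `𝒮⁺`. -/
  exists_above : ∃ x ∈ Sm, ∃ y ∈ Sp, SameVertical b x y ∧ height b y < height b x
  /-- On a neighbourhood `V` of `Γ` in the closure of `𝒮⁻`, there is a point of `𝒮⁻` below, with
  no point of `𝒮⁺` strictly in between. -/
  near_boundary : ∃ V : Set (Euc (n + 1)), V ⊆ closure Sm ∧
    (∃ O : Set (Euc (n + 1)), IsOpen O ∧ Γ ⊆ O ∧ O ∩ closure Sm ⊆ V) ∧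
    ∀ a ∈ V, ∃ u ∈ Sm, SameVertical b a u ∧ height b u < height b a ∧
      ¬ ∃ v ∈ Sp, SameVertical b a v ∧ height b v < height b a ∧ height b u < height b v
  /-- Between a point of `Γ` and a point of `𝒮⁻` above it there is a point of `𝒮⁺`. -/
  above_boundary : ∀ z ∈ Γ, ∀ c ∈ Sm, SameVertical b z c → height b z < height b c →
    ∃ w ∈ Sp, SameVertical b z w ∧ height b w < height b c ∧ height b z < height b w

end Ordering

/-! The argument compares two sheets of the shrinker along one well-chosen direction `e` in `A`.
Call `e` bitangent if some line in direction `e` meets the hypersurface at two distinct points with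
the same tangent hyperplane, and this hyperplane contains `e`. Almost no direction is bitangent
(`toSphere_bitangent`), so `A`, having positive measure, contains a direction that is not.

Bitangent directions form a null set by Sard and Fubini. Near a bitangent pair both sheets are
graphs of `u₁`, `u₂` over one hyperplane. In the cone spanned by the differences of bitangent pairs,
the slice over a fixed horizontal vector `c` consists of critical values of `(b, τ) ↦ τ (u₁ (b + c /
τ) - u₂ b)`. So every slice is null, hence the cone is null, and so is its trace on the sphere.

For the chosen `e`, consider the gaps `s > 0` such that `y ∈ Sp` and `y + s • e ∈ Sm`. Separated
ends confine pairs with bounded gap to a compact region, and the ordering conditions keep a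
minimizing pair away from `Γ`, so a least gap is attained (`IsSeparation.exists_min_height`). At a
minimizing pair the tangent hyperplanes coincide, since transverse sheets could be moved to shorten
the gap. If `e` is not tangent, both sheets are graphs in direction `e`, and `u₁ - u₂` has a local
minimum with value `s > 0`. There the gradients agree and the Hessian of `u₁ - u₂` is nonnegative,
whereas the shrinker equation makes its trace over the common tangent plane equal to `-s / 2`
(`IsSelfShrinker.isBitangent_of_min`). Hence `e` is tangent, so it is bitangent, a contradiction. -/

/-! ### Sard's theorem for real-valued functions of finite smoothness. -/

section Sard

/-- Iterated mean value inequality: if the derivatives of orders `1, …, N` vanish at `x`, then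
`h` varies at most like `‖y - x‖ ^ (N + 1)`. -/
theorem norm_sub_le_of_iteratedFDeriv_eq_zero {E : Type} [NormedAddCommGroup E] [NormedSpace ℝ E]
    (N : ℕ) {W : Type} [NormedAddCommGroup W] [NormedSpace ℝ W] {h : E → W} {B : Set E}
    (hB : Convex ℝ B) (hh : ∀ x ∈ B, ContDiffAt ℝ (N + 1 : ℕ) h x) {C : ℝ}
    (hC : ∀ x ∈ B, ‖iteratedFDeriv ℝ (N + 1) h x‖ ≤ C) {x : E} (hx : x ∈ B)
    (h0 : ∀ j, 1 ≤ j → j ≤ N → iteratedFDeriv ℝ j h x = 0) {y : E} (hy : y ∈ B) :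
    ‖h y - h x‖ ≤ C * ‖y - x‖ ^ (N + 1) := by
  induction N generalizing W y with
  | zero =>
    simp only [zero_add, pow_one]
    refine hB.norm_image_sub_le_of_norm_fderiv_le (𝕜 := ℝ)
      (fun z hz => (hh z hz).differentiableAt (by simp)) (fun z hz => ?_) hx hy
    have := hC z hz
    rwa [← norm_iteratedFDeriv_fderiv, norm_iteratedFDeriv_zero] at this
  | succ N ih =>
    have hC0 : 0 ≤ C := (norm_nonneg _).trans (hC x hx)
    have hd : ∀ z ∈ B, ‖fderiv ℝ h z‖ ≤ C * ‖z - x‖ ^ (N + 1) := by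
      intro z hz
      have hx0 : fderiv ℝ h x = 0 := by
        have := h0 1 le_rfl (by omega)
        rw [← norm_eq_zero, ← norm_iteratedFDeriv_fderiv, norm_iteratedFDeriv_zero,
          norm_eq_zero] at this
        exact this
      have := ih (h := fderiv ℝ h) (fun w hw => (hh w hw).fderiv_right (by norm_cast))
        (fun w hw => by rw [norm_iteratedFDeriv_fderiv]; exact hC w hw)
        (fun j hj1 hj2 => by
          rw [← norm_eq_zero, norm_iteratedFDeriv_fderiv, h0 (j + 1) (by omega) (by omega),
            norm_zero]) hz
      rwa [hx0, sub_zero] at this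
    have hseg : segment ℝ x y ⊆ B := hB.segment_subset hx hy
    have := (convex_segment x y).norm_image_sub_le_of_norm_fderiv_le (𝕜 := ℝ) (f := h)
      (C := C * ‖y - x‖ ^ (N + 1))
      (fun z hz => (hh z (hseg hz)).differentiableAt (by simp))
      (fun z hz => (hd z (hseg hz)).trans (by
        gcongr
        exact norm_sub_le_of_mem_segment hz)) (left_mem_segment ℝ x y) (right_mem_segment ℝ x y)
    rw [pow_succ, ← mul_assoc]
    exact this

/-- By the iterated mean value inequality `g` is locally Hölder of exponent `N + 1` on `Z`, so the
image has Hausdorff dimension at most `dim E / (N + 1) < 1`. -/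
theorem volume_image_null_of_flat {E : Type} [NormedAddCommGroup E] [NormedSpace ℝ E]
    [FiniteDimensional ℝ E] {N : ℕ} (hN : Module.finrank ℝ E < N + 1) {g : E → ℝ} {Z : Set E}
    (hg : ∀ x ∈ Z, ContDiffAt ℝ (N + 1 : ℕ) g x)
    (h0 : ∀ x ∈ Z, ∀ j, 1 ≤ j → j ≤ N → iteratedFDeriv ℝ j g x = 0) : volume (g '' Z) = 0 := by
  suffices dimH (g '' Z) < 1 by
    have h := hausdorffMeasure_of_dimH_lt (d := 1) (by simpa using this)
    rw [NNReal.coe_one, hausdorffMeasure_real] at h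
    exact h
  refine lt_of_le_of_lt (dimH_image_le_of_locally_holder_on (r := N + 1) (by positivity)
    (fun x hx => ?_)) (lt_of_le_of_lt (ENNReal.div_le_div_right (b := Module.finrank ℝ E) ?_ _) ?_)
  · have hcont : ContinuousAt (iteratedFDeriv ℝ (N + 1) g) x :=
      ((hg x hx).iteratedFDeriv_right (m := 0) (i := N + 1) (by norm_cast; simp)).continuousAt
    have h1 : ∀ᶠ y in 𝓝 x, ‖iteratedFDeriv ℝ (N + 1) g y‖ <
      ‖iteratedFDeriv ℝ (N + 1) g x‖ + 1 := hcont.norm.eventually_lt_const (by linarith)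
    have h2 := (hg x hx).eventually (by simp)
    obtain ⟨ε, hε, hb⟩ := Metric.eventually_nhds_iff_ball.1 (h1.and h2)
    refine ⟨(‖iteratedFDeriv ℝ (N + 1) g x‖ + 1).toNNReal, Metric.ball x ε ∩ Z,
      inter_comm _ _ ▸ inter_mem_nhdsWithin Z (Metric.ball_mem_nhds x hε), ?_⟩
    intro a ha b hb'
    have := norm_sub_le_of_iteratedFDeriv_eq_zero N (convex_ball x ε)
      (fun z hz => (hb z hz).2) (fun z hz => (hb z hz).1.le) ha.1 (h0 a ha.2) hb'.1
    rw [edist_comm, edist_comm a b, edist_dist, edist_dist, dist_eq_norm, dist_eq_norm]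
    have e1 : ((N + 1 : NNReal) : ℝ) = ((N + 1 : ℕ) : ℝ) := by push_cast; rfl
    rw [e1, ENNReal.rpow_natCast, ← ENNReal.ofReal_pow (norm_nonneg _)]
    change _ ≤ ENNReal.ofReal _ * _
    rw [← ENNReal.ofReal_mul (by positivity)]
    exact ENNReal.ofReal_le_ofReal this
  · rw [← Real.dimH_univ_eq_finrank]
    exact dimH_mono (subset_univ _)
  · refine ENNReal.div_lt_of_lt_mul ?_
    rw [one_mul]
    have : ((N + 1 : NNReal) : ENNReal) = ((N + 1 : ℕ) : ENNReal) := by push_cast; rfl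
    rw [this]
    exact_mod_cast hN

/-- Near a zero of `h` where `Dh ≠ 0`, the zero set of `h` is parametrized by `ker Dh`. -/
theorem exists_param_zeroSet {E : Type} [NormedAddCommGroup E] [NormedSpace ℝ E]
    [FiniteDimensional ℝ E] {k : ℕ} (hk : 1 ≤ k) {h : E → ℝ} {x₀ : E} (hh : ContDiffAt ℝ k h x₀)
    (hd : fderiv ℝ h x₀ ≠ 0) :
    ∃ (P : E → (fderiv ℝ h x₀).ker) (ψ : (fderiv ℝ h x₀).ker → E),
      ∀ᶠ x in 𝓝 x₀, h x = 0 → ψ (P x) = x ∧ ContDiffAt ℝ k ψ (P x) := by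
  set L := fderiv ℝ h x₀ with hL
  have hk0 : (k : WithTop ℕ∞) ≠ 0 := by exact_mod_cast (by omega : k ≠ 0)
  have hstrict : HasStrictFDerivAt h L x₀ := hh.hasStrictFDerivAt hk0
  obtain ⟨P, hP⟩ := L.ker_closedComplemented_of_finiteDimensional_range
  have hsurj : L.range = ⊤ := by
    rw [LinearMap.range_eq_top]
    refine LinearMap.surjective (f := L.toLinearMap) ?_
    intro h
    exact hd (by ext x; exact congrArg (fun l : E →ₗ[ℝ] ℝ => l x) h)
  let φ : ImplicitFunctionData ℝ E ℝ L.ker :=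
    { leftFun := h
      leftDeriv := L
      rightFun := P
      rightDeriv := P
      pt := x₀
      hasStrictFDerivAt_leftFun := hstrict
      hasStrictFDerivAt_rightFun := P.hasStrictFDerivAt
      range_leftDeriv := hsurj
      range_rightDeriv := LinearMap.range_eq_top.2 fun y => ⟨y, hP y⟩
      isCompl_ker := LinearMap.isCompl_of_proj hP }
  refine ⟨P, φ.implicitFunction 0, ?_⟩
  have hc : ContDiffAt ℝ k φ.implicitFunction.uncurry (φ.prodFun φ.pt) :=
    φ.contDiffAt_implicitFunction hh P.contDiff.contDiffAt hk0
  have hcont : ContinuousAt φ.prodFun x₀ := hh.continuousAt.prodMk P.continuous.continuousAt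
  -- The order `k` is finite: only then does `ContDiffAt` at one point persist at nearby points.
  have h1 := hcont.eventually (hc.eventually (by simp))
  have h2 : ∀ᶠ x in 𝓝 x₀, φ.implicitFunction (φ.leftFun x) (φ.rightFun x) = x :=
    φ.implicitFunction_apply_image
  filter_upwards [h1, h2] with x hx1 hx2 hx0
  have e1 : φ.leftFun x = 0 := hx0
  rw [e1] at hx2
  refine ⟨hx2, ?_⟩
  have e2 : φ.prodFun x = (0, P x) := by
    change (h x, P x) = _
    rw [hx0]
  rw [e2] at hx1
  exact hx1.comp (P x) (contDiffAt_const.prodMk contDiffAt_id)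

/-- **Sard's theorem** for real functions: on a space of dimension `d`, the critical values of a
sufficiently smooth function form a null set. -/
theorem exists_sard_real (d : ℕ) : ∃ k : ℕ, 1 ≤ k ∧ ∀ (E : Type) [NormedAddCommGroup E]
    [NormedSpace ℝ E] [FiniteDimensional ℝ E], Module.finrank ℝ E = d → ∀ (g : E → ℝ) (Z : Set E),
    (∀ x ∈ Z, ContDiffAt ℝ k g x ∧ fderiv ℝ g x = 0) → volume (g '' Z) = 0 := by
  induction d with
  | zero =>
    refine ⟨1, le_rfl, fun E _ _ _ hE g Z _ => ?_⟩
    have : Subsingleton E := Module.finrank_zero_iff.1 hE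
    exact ((Set.subsingleton_of_subsingleton (s := Z)).image g).measure_zero volume
  | succ d ih =>
    obtain ⟨k, hk1, hk⟩ := ih
    -- Order `d + 2` handles the points flat to order `d + 1`. Elsewhere at most `d` derivatives are
    -- lost in passing to a component of `iteratedFDeriv ℝ i g`, which leaves at least the `k` of
    -- the induction hypothesis.
    refine ⟨k + (d + 2), by omega, fun E _ _ _ hE g Z hZ => ?_⟩
    let F (i : ℕ) : Set E := {x ∈ Z | ∀ j, 1 ≤ j → j ≤ i → iteratedFDeriv ℝ j g x = 0}
    have hF1 : Z ⊆ F 1 := by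
      refine fun x hx => ⟨hx, fun j hj1 hj2 => ?_⟩
      obtain rfl : j = 0 + 1 := by omega
      rw [← norm_eq_zero, ← norm_iteratedFDeriv_fderiv, norm_iteratedFDeriv_zero, (hZ x hx).2,
        norm_zero]
    have hlast : volume (g '' F (d + 1)) = 0 :=
      volume_image_null_of_flat (N := d + 1) (by omega)
        (fun x hx => (hZ x hx.1).1.of_le (by norm_cast; omega)) (fun x hx => hx.2)
    have hstep : ∀ i, 1 ≤ i → i ≤ d → volume (g '' (F i \ F (i + 1))) = 0 := by
      intro i hi1 hid
      -- The pullback outer measure `s ↦ volume (g '' s)` lets the countable covering argument run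
      -- in the domain.
      refine measure_null_of_locally_null
        (μ := OuterMeasure.comap g (volume : Measure ℝ).toOuterMeasure) _ fun x₀ hx₀ => ?_
      have hne : iteratedFDeriv ℝ (i + 1) g x₀ ≠ 0 := by
        intro h0
        refine hx₀.2 ⟨hx₀.1.1, fun j hj1 hj2 => ?_⟩
        rcases Nat.lt_or_ge i j with h | h
        · obtain rfl : j = i + 1 := by omega
          exact h0
        · exact hx₀.1.2 j hj1 h
      have hsm : ContDiffAt ℝ k (iteratedFDeriv ℝ i g) x₀ :=
        (hZ x₀ hx₀.1.1).1.iteratedFDeriv_right (by norm_cast; omega)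
      have hk0 : (k : WithTop ℕ∞) ≠ 0 := by exact_mod_cast (by omega : k ≠ 0)
      have hdiff := hsm.differentiableAt hk0
      have hne' : fderiv ℝ (iteratedFDeriv ℝ i g) x₀ ≠ 0 := by
        intro h
        refine hne (norm_eq_zero.1 (norm_fderiv_iteratedFDeriv.symm.trans ?_))
        rw [h]
        exact norm_zero (E := E →L[ℝ] E [×i]→L[ℝ] ℝ)
      obtain ⟨v, hv⟩ : ∃ v, fderiv ℝ (iteratedFDeriv ℝ i g) x₀ v ≠ 0 := by
        by_contra! h
        exact hne' (ContinuousLinearMap.ext h)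
      obtain ⟨m, hm⟩ : ∃ m, fderiv ℝ (iteratedFDeriv ℝ i g) x₀ v m ≠ 0 := by
        by_contra! h
        exact hv (ContinuousMultilinearMap.ext h)
      -- A component `h` of the `i`-th derivative vanishes on `F i` and has nonzero differential at
      -- `x₀`. Thus `F i` lies locally in a hypersurface of dimension `d`, on which `g` still has
      -- critical points, and the induction hypothesis applies.
      let ev := ContinuousMultilinearMap.apply ℝ (fun _ : Fin i => E) ℝ m
      let h : E → ℝ := fun x => ev (iteratedFDeriv ℝ i g x)
      have hh : ContDiffAt ℝ k h x₀ := ev.contDiff.contDiffAt.comp x₀ hsm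
      have hzero : ∀ x ∈ F i, h x = 0 := fun x hx => by
        change ev (iteratedFDeriv ℝ i g x) = 0
        rw [hx.2 i hi1 le_rfl, map_zero]
      have hhd : fderiv ℝ h x₀ ≠ 0 := by
        have : HasFDerivAt h (ev ∘L fderiv ℝ (iteratedFDeriv ℝ i g) x₀) x₀ :=
          ev.hasFDerivAt.comp x₀ hdiff.hasFDerivAt
        rw [this.fderiv]
        exact fun h0 => hm (congrArg (fun l : E →L[ℝ] ℝ => l v) h0)
      obtain ⟨P, ψ, hψ⟩ := exists_param_zeroSet hk1 hh hhd
      refine ⟨(F i \ F (i + 1)) ∩ {x | h x = 0 → ψ (P x) = x ∧ ContDiffAt ℝ k ψ (P x)},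
        inter_mem self_mem_nhdsWithin (mem_nhdsWithin_of_mem_nhds hψ), ?_⟩
      rw [OuterMeasure.comap_apply]
      change volume _ = 0
      set K : Set E := (F i \ F (i + 1)) ∩ {x | h x = 0 → ψ (P x) = x ∧ ContDiffAt ℝ k ψ (P x)}
      have hsub : g '' K ⊆ (g ∘ ψ) '' (P '' K) := by
        rintro _ ⟨x, hx, rfl⟩
        exact ⟨P x, ⟨x, hx, rfl⟩, congrArg g (hx.2 (hzero x hx.1.1)).1⟩
      refine measure_mono_null hsub (hk (fderiv ℝ h x₀).ker ?_ _ _ ?_)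
      · have := Module.Dual.finrank_ker_add_one_of_ne_zero (f := (fderiv ℝ h x₀).toLinearMap)
          (fun h0 => hhd (ContinuousLinearMap.coe_injective h0))
        have e : Module.finrank ℝ (fderiv ℝ h x₀).ker =
          Module.finrank ℝ (fderiv ℝ h x₀).toLinearMap.ker := rfl
        omega
      · rintro _ ⟨x, hx, rfl⟩
        obtain ⟨hx1, hx2⟩ := hx.2 (hzero x hx.1.1)
        have hgx := hZ x hx.1.1.1
        have hg' : ContDiffAt ℝ k g (ψ (P x)) := by
          rw [hx1]; exact hgx.1.of_le (by norm_cast; omega)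
        refine ⟨hg'.comp _ hx2, ?_⟩
        rw [fderiv_comp _ (hg'.differentiableAt hk0) (hx2.differentiableAt hk0), hx1, hgx.2]
        simp
    have hall : ∀ i, 1 ≤ i → i ≤ d + 1 → volume (g '' (F 1 \ F i)) = 0 := by
      intro i hi
      induction i, hi using Nat.le_induction with
      | base => simp
      | succ i hi ih2 =>
        intro hid
        refine measure_mono_null ?_
          (measure_union_null (ih2 (by omega)) (hstep i hi (by omega)))
        rw [← image_union]
        refine image_mono fun x hx => ?_
        by_cases hxi : x ∈ F i
        · exact Or.inr ⟨hxi, hx.2⟩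
        · exact Or.inl ⟨hx.1, hxi⟩
    refine measure_mono_null ?_ (measure_union_null (hall (d + 1) (by omega) le_rfl) hlast)
    rw [← image_union]
    refine image_mono fun x hx => ?_
    by_cases hxi : x ∈ F (d + 1)
    · exact Or.inr hxi
    · exact Or.inl ⟨hF1 hx, hxi⟩

end Sard

/-! ### Immersed hypersurfaces as local graphs over the orthogonal complement of a transverse
direction. -/

section Graphs

/-- The inverse function theorem for smooth maps, with an inverse smooth on an open set. -/
theorem exists_smooth_localInverse {E E' : Type*} [NormedAddCommGroup E] [NormedSpace ℝ E]
    [CompleteSpace E] [NormedAddCommGroup E'] [NormedSpace ℝ E'] {f : E → E'} {U : Set E}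
    (hU : IsOpen U) (hf : ContDiffOn ℝ ∞ f U) {a : E} (ha : a ∈ U) (f' : E ≃L[ℝ] E')
    (hf' : HasFDerivAt f (f' : E →L[ℝ] E') a) :
    ∃ (W : Set E') (g : E' → E), IsOpen W ∧ f a ∈ W ∧ ContDiffOn ℝ ∞ g W ∧ MapsTo g W U ∧
      (∀ z ∈ W, f (g z) = z) ∧ ∀ᶠ x in 𝓝 a, g (f x) = x := by
  have hinf : (∞ : WithTop ℕ∞) ≠ 0 := by simp
  have hat : ∀ x ∈ U, ContDiffAt ℝ ∞ f x := fun x hx => hf.contDiffAt (hU.mem_nhds hx)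
  let e := (hat a ha).toOpenPartialHomeomorph f hf' hinf
  have hae : a ∈ e.source := (hat a ha).mem_toOpenPartialHomeomorph_source hf' hinf
  have heq : ∀ x, e x = f x := fun x => rfl
  -- Invertibility of the derivative is an open condition, so the local inverse is smooth on a whole
  -- open set and not only at `f a`.
  let D : Set E := U ∩ fderiv ℝ f ⁻¹' range ((↑) : (E ≃L[ℝ] E') → E →L[ℝ] E')
  have hD : IsOpen D := (hf.continuousOn_fderiv_of_isOpen hU (by simp)).isOpen_inter_preimage hU
    ContinuousLinearEquiv.isOpen
  have haD : a ∈ D := ⟨ha, f', hf'.fderiv.symm⟩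
  refine ⟨e.target ∩ e.symm ⁻¹' D, e.symm, e.symm.isOpen_inter_preimage hD, ?_, ?_, ?_, ?_, ?_⟩
  · refine ⟨e.map_source hae, ?_⟩
    change e.symm (e a) ∈ D
    rwa [e.left_inv hae]
  · rintro z ⟨hz, hzU, e', he'⟩
    refine (e.contDiffAt_symm hz (f₀' := e') ?_ (hat _ hzU)).contDiffWithinAt
    rw [he']
    exact ((hat _ hzU).differentiableAt hinf).hasFDerivAt
  · exact fun z hz => hz.2.1
  · exact fun z hz => e.right_inv hz.1
  · filter_upwards [e.open_source.mem_nhds hae] with x hx using e.left_inv hx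

/-- The differential of a map of a manifold into a Euclidean space. -/
noncomputable def diffAt {d k : ℕ} {M : Type*} [TopologicalSpace M] [ChartedSpace (Euc d) M]
    (F : M → Euc k) (p : M) : Euc d →L[ℝ] Euc k :=
  mfderiv (𝓡 d) 𝓘(ℝ, Euc k) F p

variable {d k : ℕ} {M : Type*} [TopologicalSpace M] [ChartedSpace (Euc d) M]

theorem hasFDerivAt_comp_extChartAt_symm {F : M → Euc k} {p : M}
    (hF : MDifferentiableAt (𝓡 d) 𝓘(ℝ, Euc k) F p) :
    HasFDerivAt (F ∘ (extChartAt (𝓡 d) p).symm) (diffAt F p) (extChartAt (𝓡 d) p p) := by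
  have : HasFDerivWithinAt (F ∘ (extChartAt (𝓡 d) p).symm) (diffAt F p) (range (𝓡 d))
    (extChartAt (𝓡 d) p p) := hF.hasMFDerivAt.2
  rwa [ModelWithCorners.range_eq_univ, hasFDerivWithinAt_univ] at this

variable [IsManifold (𝓡 d) ∞ M]

theorem contDiffOn_comp_extChartAt_symm {F : M → Euc k}
    (hF : ContMDiff (𝓡 d) 𝓘(ℝ, Euc k) ∞ F) (p : M) :
    ContDiffOn ℝ ∞ (F ∘ (extChartAt (𝓡 d) p).symm) (extChartAt (𝓡 d) p).target :=
  contMDiffOn_iff_contDiffOn.1 (hF.comp_contMDiffOn (contMDiffOn_extChartAt_symm p))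

/-- The orthogonal projection along `e`. -/
noncomputable abbrev projPerp {E : Type*} [NormedAddCommGroup E] [InnerProductSpace ℝ E] (e : E) :
    E →L[ℝ] (ℝ ∙ e)ᗮ :=
  (ℝ ∙ e)ᗮ.orthogonalProjectionOnto

section
variable {E : Type*} [NormedAddCommGroup E] [InnerProductSpace ℝ E] {e : E}

theorem projPerp_add_inner (he : ‖e‖ = 1) (x : E) : (projPerp e x : E) + ⟪e, x⟫ • e = x := by
  have := Submodule.starProjection_add_starProjection_orthogonal (K := ℝ ∙ e) x
  rw [Submodule.starProjection_unit_singleton ℝ he, add_comm] at this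
  exact this

theorem projPerp_coe_add_smul (z : (ℝ ∙ e)ᗮ) (t : ℝ) :
    projPerp e ((z : E) + t • e) = z := by
  rw [map_add, map_smul, Submodule.orthogonalProjectionOnto_mem_subspace_eq_self,
    Submodule.orthogonalProjectionOnto_orthogonal_apply_eq_zero (Submodule.mem_span_singleton_self e),
    smul_zero, add_zero]

theorem inner_coe_add_smul (he : ‖e‖ = 1) (z : (ℝ ∙ e)ᗮ) (t : ℝ) :
    ⟪e, (z : E) + t • e⟫ = t := by
  rw [inner_add_right, inner_smul_right, real_inner_self_eq_norm_sq, he,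
    Submodule.mem_orthogonal_singleton_iff_inner_right.1 z.2]
  simp

theorem inner_self_unit (he : ‖e‖ = 1) : ⟪e, e⟫ = (1 : ℝ) := by
  rw [real_inner_self_eq_norm_sq, he]; norm_num

theorem projPerp_self : projPerp e e = 0 :=
  Submodule.orthogonalProjectionOnto_orthogonal_apply_eq_zero (Submodule.mem_span_singleton_self e)

end

theorem finrank_perp {e : Euc (d + 1)} (he : ‖e‖ = 1) : Module.finrank ℝ (ℝ ∙ e)ᗮ = d := by
  have : Fact (Module.finrank ℝ (Euc (d + 1)) = d + 1) := ⟨by simp⟩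
  exact Submodule.finrank_orthogonal_span_singleton (by rintro rfl; simp at he)

/-- An immersed hypersurface is locally a graph in each direction transverse to its
tangent space. -/
theorem exists_graph {F : M → Euc (d + 1)} (hF : IsSmoothImmersion (d := d) F) {p : M}
    {e : Euc (d + 1)} (he : ‖e‖ = 1) (hep : e ∉ (diffAt (d := d) F p).range) :
    ∃ (u : (ℝ ∙ e)ᗮ → ℝ) (W : Set (ℝ ∙ e)ᗮ), IsOpen W ∧ projPerp e (F p) ∈ W ∧
      ContDiffOn ℝ ∞ u W ∧ (∀ O ∈ 𝓝 p, ∀ᶠ z : (ℝ ∙ e)ᗮ in 𝓝 (projPerp e (F p)),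
        (z : Euc (d + 1)) + u z • e ∈ F '' O) ∧
      ∀ᶠ p' in 𝓝 p, ⟪e, F p'⟫ = u (projPerp e (F p')) := by
  set φ := extChartAt (𝓡 d) p with hφ
  set f := F ∘ φ.symm with hf
  -- A tangent vector killed by the projection is a multiple of `e`, hence zero because `e` is not
  -- tangent.
  have hinj : Function.Injective (projPerp e ∘L diffAt (d := d) F p) := by
    refine (injective_iff_map_eq_zero _).2 fun v hv => ?_
    have h1 := projPerp_add_inner he (diffAt (d := d) F p v)
    have hv' : projPerp e (diffAt (d := d) F p v) = 0 := hv
    rw [hv', ZeroMemClass.coe_zero, zero_add] at h1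
    have h2 : ⟪e, diffAt (d := d) F p v⟫ = 0 := by
      by_contra hne
      refine hep ⟨(⟪e, diffAt (d := d) F p v⟫)⁻¹ • v, ?_⟩
      change diffAt (d := d) F p _ = e
      rw [map_smul, ← h1, inner_smul_right, inner_self_unit he, mul_one, smul_smul,
        inv_mul_cancel₀ hne, one_smul]
    rw [h2, zero_smul] at h1
    exact hF.2 p (h1.symm.trans (map_zero (diffAt (d := d) F p)).symm)
  let K : Euc d ≃L[ℝ] (ℝ ∙ e)ᗮ :=
    (LinearEquiv.ofInjectiveOfFinrankEq (projPerp e ∘L diffAt (d := d) F p).toLinearMap hinj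
      (by rw [finrank_perp he]; simp)).toContinuousLinearEquiv
  have hK : (K : Euc d →L[ℝ] (ℝ ∙ e)ᗮ) = projPerp e ∘L diffAt (d := d) F p := by
    ext v; rfl
  have hφp : φ p ∈ φ.target := mem_extChartAt_target p
  have hfp : f (φ p) = F p := congrArg F (extChartAt_to_inv p)
  have hfsm : ContDiffOn ℝ ∞ f φ.target := contDiffOn_comp_extChartAt_symm hF.1 p
  obtain ⟨W, g, hW, hpW, hg, hgU, hfg, hgf⟩ := exists_smooth_localInverse
    (f := projPerp e ∘ f) (isOpen_extChartAt_target p)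
    ((projPerp e).contDiff.comp_contDiffOn hfsm) hφp K (by
      rw [hK]
      exact (projPerp e).hasFDerivAt.comp _
        (hasFDerivAt_comp_extChartAt_symm (hF.1.mdifferentiable (by simp) p)))
  simp only [Function.comp_apply, hfp] at hpW hfg hgf
  have hgp : g (projPerp e (F p)) = φ p := by
    have := hgf.self_of_nhds
    rwa [hfp] at this
  refine ⟨fun z => ⟪e, f (g z)⟫, W, hW, hpW, ?_, fun O hO => ?_, ?_⟩
  · exact (contDiff_const.inner ℝ contDiff_id).comp_contDiffOn (hfsm.comp hg hgU)
  · have hcont : ContinuousAt (fun z => φ.symm (g z)) (projPerp e (F p)) := by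
      refine ContinuousAt.comp ?_ (hg.continuousOn.continuousAt (hW.mem_nhds hpW))
      rw [hgp]
      exact continuousAt_extChartAt_symm p
    have hO' : O ∈ 𝓝 (φ.symm (g (projPerp e (F p)))) := by
      rw [hgp]
      convert hO
      exact extChartAt_to_inv p
    filter_upwards [hcont.eventually_mem hO', hW.mem_nhds hpW] with z hz hzW
    refine ⟨_, hz, ?_⟩
    have := projPerp_add_inner he (f (g z))
    rw [hfg z hzW] at this
    exact this.symm
  · have h1 := (continuousAt_extChartAt (I := 𝓡 d) p).eventually hgf
    filter_upwards [h1, extChartAt_source_mem_nhds (I := 𝓡 d) p] with q hq hqs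
    have e1 : f (φ q) = F q := congrArg F (φ.left_inv hqs)
    change g (projPerp e (f (φ q))) = φ q at hq
    rw [e1] at hq
    rw [hq, e1]

end Graphs

/-! ### Bitangent directions of a pair of graphs form a null set. -/

section BitangentDirections

/-- The pairs of base points of two graphs over `V` at which the tangent hyperplanes coincide. -/
def bitangentPairs {V : Type} [NormedAddCommGroup V] [NormedSpace ℝ V] (u₁ u₂ : V → ℝ)
    (A₁ A₂ : Set V) : Set (V × V) :=
  {x | x.1 ∈ A₁ ∧ x.2 ∈ A₂ ∧ fderiv ℝ u₁ x.1 = fderiv ℝ u₂ x.2 ∧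
    u₁ x.1 - u₂ x.2 = fderiv ℝ u₁ x.1 (x.1 - x.2)}

/-- The difference of two points lying on two graphs over `V`. -/
def graphDiff {V : Type} [NormedAddCommGroup V] [NormedSpace ℝ V] (u₁ u₂ : V → ℝ)
    (x : V × V) : V × ℝ :=
  (x.1 - x.2, u₁ x.1 - u₂ x.2)

variable {V : Type} [NormedAddCommGroup V] [NormedSpace ℝ V]
  {u₁ u₂ : V → ℝ} {W₁ W₂ A₁ A₂ : Set V}

theorem continuousOn_graphDiff (h₁ : ContDiffOn ℝ ∞ u₁ W₁) (h₂ : ContDiffOn ℝ ∞ u₂ W₂)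
    (hA₁ : A₁ ⊆ W₁) (hA₂ : A₂ ⊆ W₂) :
    ContinuousOn (graphDiff u₁ u₂) (bitangentPairs u₁ u₂ A₁ A₂) := by
  refine (continuousOn_fst.sub continuousOn_snd).prodMk
    ((h₁.continuousOn.comp continuousOn_fst fun x hx => hA₁ hx.1).sub
      (h₂.continuousOn.comp continuousOn_snd fun x hx => hA₂ hx.2.1))

theorem isCompact_bitangentPairs (hW₁ : IsOpen W₁) (hW₂ : IsOpen W₂)
    (h₁ : ContDiffOn ℝ ∞ u₁ W₁) (h₂ : ContDiffOn ℝ ∞ u₂ W₂)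
    (hA₁ : A₁ ⊆ W₁) (hA₂ : A₂ ⊆ W₂) (hc₁ : IsCompact A₁) (hc₂ : IsCompact A₂) :
    IsCompact (bitangentPairs u₁ u₂ A₁ A₂) := by
  have c1 : ContinuousOn (fun x : V × V => fderiv ℝ u₁ x.1) (A₁ ×ˢ A₂) :=
    (h₁.continuousOn_fderiv_of_isOpen hW₁ (by simp)).comp continuousOn_fst fun x hx => hA₁ hx.1
  have c2 : ContinuousOn (fun x : V × V => fderiv ℝ u₂ x.2) (A₁ ×ˢ A₂) :=
    (h₂.continuousOn_fderiv_of_isOpen hW₂ (by simp)).comp continuousOn_snd fun x hx => hA₂ hx.2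
  have c3 : ContinuousOn (fun x : V × V => u₁ x.1) (A₁ ×ˢ A₂) :=
    h₁.continuousOn.comp continuousOn_fst fun x hx => hA₁ hx.1
  have c4 : ContinuousOn (fun x : V × V => u₂ x.2) (A₁ ×ˢ A₂) :=
    h₂.continuousOn.comp continuousOn_snd fun x hx => hA₂ hx.2
  have c5 : ContinuousOn (fun x : V × V => (fderiv ℝ u₁ x.1 - fderiv ℝ u₂ x.2,
      u₁ x.1 - u₂ x.2 - fderiv ℝ u₁ x.1 (x.1 - x.2))) (A₁ ×ˢ A₂) :=
    (c1.sub c2).prodMk ((c3.sub c4).sub (c1.clm_apply (continuousOn_fst.sub continuousOn_snd)))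
  have hc := hc₁.prod hc₂
  obtain ⟨C, hC, hC'⟩ := (continuousOn_iff_isClosed.1 c5) {0} isClosed_singleton
  have : bitangentPairs u₁ u₂ A₁ A₂ = C ∩ A₁ ×ˢ A₂ := by
    rw [← hC']
    ext x
    simp only [bitangentPairs, mem_ofPred_eq, mem_inter_iff, mem_preimage, mem_singleton_iff,
      Prod.mk_eq_zero, sub_eq_zero, mem_prod]
    tauto
  rw [this]
  exact hc.inter_left hC

/-- Since `a = b + τ⁻¹ • c`, the derivative in `b` is `τ (Du₁(a) - Du₂(b))` and the derivative in
`τ` is `u₁(a) - u₂(b) - Du₁(a)(a - b)`. The two bitangency equations say exactly that these vanish.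
-/
theorem fderiv_slice_eq_zero {a b c : V} {τ : ℝ} (hτ : τ ≠ 0) (hc : c = τ • (a - b))
    (h₁ : DifferentiableAt ℝ u₁ a) (h₂ : DifferentiableAt ℝ u₂ b)
    (hd : fderiv ℝ u₁ a = fderiv ℝ u₂ b) (hu : u₁ a - u₂ b = fderiv ℝ u₁ a (a - b)) :
    fderiv ℝ (fun x : V × ℝ => x.2 * (u₁ (x.1 + x.2⁻¹ • c) - u₂ x.1)) (b, τ) = 0 := by
  have ha : b + τ⁻¹ • c = a := by
    rw [hc, smul_smul, inv_mul_cancel₀ hτ, one_smul, add_sub_cancel]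
  have d1 : HasFDerivAt (fun x : V × ℝ => x.2⁻¹)
      ((-(τ ^ 2)⁻¹) • ContinuousLinearMap.snd ℝ V ℝ) (b, τ) :=
    (hasDerivAt_inv hτ).comp_hasFDerivAt (b, τ) hasFDerivAt_snd
  have d2 : HasFDerivAt (fun x : V × ℝ => x.1 + x.2⁻¹ • c)
      (ContinuousLinearMap.fst ℝ V ℝ +
        ((-(τ ^ 2)⁻¹) • ContinuousLinearMap.snd ℝ V ℝ).smulRight c) (b, τ) :=
    hasFDerivAt_fst.add (d1.smul_const c)
  have h₁' : HasFDerivAt u₁ (fderiv ℝ u₁ a) ((fun x : V × ℝ => x.1 + x.2⁻¹ • c) (b, τ)) := by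
    simp only [ha]
    exact h₁.hasFDerivAt
  have d3 := h₁'.comp (b, τ) d2
  have d4 : HasFDerivAt (fun x : V × ℝ => u₂ x.1) (fderiv ℝ u₂ b ∘L ContinuousLinearMap.fst ℝ V ℝ)
      (b, τ) := h₂.hasFDerivAt.comp (b, τ) hasFDerivAt_fst
  have d5 := (hasFDerivAt_snd (𝕜 := ℝ) (p := (b, τ))).mul (d3.sub d4)
  refine d5.fderiv.trans ?_
  have e : fderiv ℝ u₁ a c = τ * (u₁ a - u₂ b) := by rw [hc, map_smul, hu, smul_eq_mul]
  ext <;> simp [ha, e, ← hd]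
  field_simp
  ring

variable [FiniteDimensional ℝ V]

/-- Fubini over the horizontal component `c`: each vertical slice consists of critical values of the
function of `fderiv_slice_eq_zero`, so Sard makes it null. -/
theorem addHaar_cone_bitangentPairs [MeasurableSpace V] [BorelSpace V]
    (μ : Measure V) [μ.IsAddHaarMeasure]
    (hW₁ : IsOpen W₁) (hW₂ : IsOpen W₂)
    (h₁ : ContDiffOn ℝ ∞ u₁ W₁) (h₂ : ContDiffOn ℝ ∞ u₂ W₂)
    (hA₁ : A₁ ⊆ W₁) (hA₂ : A₂ ⊆ W₂) (hc₁ : IsCompact A₁) (hc₂ : IsCompact A₂) :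
    (μ.prod volume) (Ioi (0 : ℝ) • (graphDiff u₁ u₂ '' bitangentPairs u₁ u₂ A₁ A₂)) = 0 := by
  have : ProperSpace V := FiniteDimensional.proper_real V
  set Q := bitangentPairs u₁ u₂ A₁ A₂ with hQ
  have hQc : IsCompact (graphDiff u₁ u₂ '' Q) :=
    (isCompact_bitangentPairs hW₁ hW₂ h₁ h₂ hA₁ hA₂ hc₁ hc₂).image_of_continuousOn
      (continuousOn_graphDiff h₁ h₂ hA₁ hA₂)
  -- Restricting the scaling factor to compact intervals makes the pieces compact, hence measurable
  -- as Fubini requires.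
  have hsub : Ioi (0 : ℝ) • (graphDiff u₁ u₂ '' Q) ⊆
      ⋃ k : ℕ, Icc ((k + 1 : ℝ)⁻¹) (k + 1) • (graphDiff u₁ u₂ '' Q) := by
    rintro _ ⟨τ, hτ, y, hy, rfl⟩
    have hτ : 0 < τ := hτ
    obtain ⟨k, hk⟩ := exists_nat_ge (max τ τ⁻¹)
    refine mem_iUnion.2 ⟨k, smul_mem_smul ⟨?_, ?_⟩ hy⟩
    · exact inv_le_of_inv_le₀ hτ (by linarith [le_max_right τ τ⁻¹])
    · linarith [le_max_left τ τ⁻¹]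
  refine measure_mono_null hsub (measure_iUnion_null fun k => ?_)
  have hK : IsCompact (Icc ((k + 1 : ℝ)⁻¹) (k + 1) • (graphDiff u₁ u₂ '' Q)) :=
    isCompact_Icc.smul_set hQc
  rw [Measure.measure_prod_null hK.measurableSet]
  refine Eventually.of_forall fun c => ?_
  obtain ⟨n, hn1, hn⟩ := exists_sard_real (Module.finrank ℝ (V × ℝ))
  have key := hn (V × ℝ) rfl (fun x : V × ℝ => x.2 * (u₁ (x.1 + x.2⁻¹ • c) - u₂ x.1))
    {x | ∃ a, 0 < x.2 ∧ (a, x.1) ∈ Q ∧ c = x.2 • (a - x.1)} ?_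
  · refine measure_mono_null ?_ key
    rintro s ⟨τ, hτ, _, ⟨⟨a, b⟩, hab, rfl⟩, hs⟩
    have hτ0 : 0 < τ := lt_of_lt_of_le (by positivity) hτ.1
    simp only [graphDiff, Prod.smul_mk, Prod.mk.injEq, smul_eq_mul] at hs
    refine ⟨(b, τ), ⟨a, hτ0, hab, hs.1.symm⟩, ?_⟩
    have : b + τ⁻¹ • c = a := by
      rw [← hs.1, smul_smul, inv_mul_cancel₀ hτ0.ne', one_smul, add_sub_cancel]
    simp only [this, hs.2]
  · rintro ⟨b, τ⟩ ⟨a, hτ, ⟨ha, hb, hd, hu⟩, hc⟩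
    have s1 : ContDiffAt ℝ ∞ u₁ a := h₁.contDiffAt (hW₁.mem_nhds (hA₁ ha))
    have s2 : ContDiffAt ℝ ∞ u₂ b := h₂.contDiffAt (hW₂.mem_nhds (hA₂ hb))
    refine ⟨?_, fderiv_slice_eq_zero hτ.ne' hc (s1.differentiableAt (by simp))
      (s2.differentiableAt (by simp)) hd hu⟩
    have e1 : b + τ⁻¹ • c = a := by
      rw [hc, smul_smul, inv_mul_cancel₀ (ne_of_gt hτ), one_smul, add_sub_cancel]
    refine ContDiffAt.of_le (n := ∞) ?_ (by exact_mod_cast le_top)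
    refine contDiffAt_snd.mul (ContDiffAt.sub ?_ (s2.comp (b, τ) contDiffAt_fst))
    refine ContDiffAt.comp (b, τ) (g := u₁) (f := fun x : V × ℝ => x.1 + x.2⁻¹ • c)
      (by simpa only [e1] using s1) ?_
    exact contDiffAt_fst.add ((contDiffAt_snd.inv (ne_of_gt hτ)).smul contDiffAt_const)

/-- The spherical measure of a measurable set is a multiple of the volume of the truncated cone over
it, and here that cone lies in the image under `L` of a null cone. The bound `r₀` keeps differences
away from `0`, where radial projection is discontinuous, so the set of directions is closed and
therefore measurable. -/
theorem toSphere_bitangentPairs {E : Type} [NormedAddCommGroup E] [InnerProductSpace ℝ E]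
    [FiniteDimensional ℝ E] [MeasurableSpace E] [BorelSpace E] (L : (V × ℝ) ≃L[ℝ] E)
    (hW₁ : IsOpen W₁) (hW₂ : IsOpen W₂)
    (h₁ : ContDiffOn ℝ ∞ u₁ W₁) (h₂ : ContDiffOn ℝ ∞ u₂ W₂)
    (hA₁ : A₁ ⊆ W₁) (hA₂ : A₂ ⊆ W₂) (hc₁ : IsCompact A₁) (hc₂ : IsCompact A₂) {r₀ : ℝ}
    (hr₀ : 0 < r₀) :
    (volume : Measure E).toSphere {e | ∃ x ∈ bitangentPairs u₁ u₂ A₁ A₂,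
      ∃ r : ℝ, r₀ ≤ r ∧ L (graphDiff u₁ u₂ x) = r • (e : E)} = 0 := by
  set Q := bitangentPairs u₁ u₂ A₁ A₂ with hQ
  have : ProperSpace V := FiniteDimensional.proper_real V
  set D : Set (Metric.sphere (0 : E) 1) :=
    {e | ∃ x ∈ Q, ∃ r : ℝ, r₀ ≤ r ∧ L (graphDiff u₁ u₂ x) = r • (e : E)} with hD
  have hQc : IsCompact (L '' (graphDiff u₁ u₂ '' Q)) :=
    ((isCompact_bitangentPairs hW₁ hW₂ h₁ h₂ hA₁ hA₂ hc₁ hc₂).image_of_continuousOn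
      (continuousOn_graphDiff h₁ h₂ hA₁ hA₂)).image L.continuous
  have hQc' : IsCompact (L '' (graphDiff u₁ u₂ '' Q) ∩ {y | r₀ ≤ ‖y‖}) :=
    hQc.inter_right (isClosed_le continuous_const continuous_norm)
  have hDm : MeasurableSet D := by
    have hcl : IsClosed ((fun y : E => ‖y‖⁻¹ • y) ''
        (L '' (graphDiff u₁ u₂ '' Q) ∩ {y | r₀ ≤ ‖y‖})) := by
      refine (hQc'.image_of_continuousOn ?_).isClosed
      refine ContinuousOn.smul (continuous_norm.continuousOn.inv₀ fun y hy => ?_) continuousOn_id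
      exact (lt_of_lt_of_le hr₀ hy.2).ne'
    convert (hcl.preimage continuous_subtype_val).measurableSet
    ext e
    have hen : ‖(e : E)‖ = 1 := by simp
    constructor
    · rintro ⟨x, hx, r, hr, hxr⟩
      have hr' : ‖r • (e : E)‖ = r := by
        rw [norm_smul, hen, mul_one, Real.norm_of_nonneg (hr₀.le.trans hr)]
      refine ⟨r • (e : E), ⟨⟨_, ⟨x, hx, rfl⟩, hxr⟩, ?_⟩, ?_⟩
      · change r₀ ≤ ‖r • (e : E)‖
        rwa [hr']
      · change ‖r • (e : E)‖⁻¹ • r • (e : E) = e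
        rw [hr', smul_smul, inv_mul_cancel₀ (by linarith), one_smul]
    · rintro ⟨_, ⟨⟨_, ⟨x, hx, rfl⟩, rfl⟩, hr⟩, hy⟩
      have hr : r₀ ≤ ‖L (graphDiff u₁ u₂ x)‖ := hr
      refine ⟨x, hx, _, hr, ?_⟩
      rw [← hy]
      simp only
      rw [smul_smul, mul_inv_cancel₀ (by linarith), one_smul]
  rw [Measure.toSphere_apply' _ hDm]
  have hnull : (volume : Measure E) (Ioo (0 : ℝ) 1 • ((↑) '' D : Set E)) = 0 := by
    borelize V
    set μ : Measure V := Measure.addHaar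
    have hac : (volume : Measure E) ≪ (μ.prod volume).map L := by
      have : ((μ.prod volume).map L).IsAddHaarMeasure := L.isAddHaarMeasure_map _
      exact Measure.absolutelyContinuous_isAddHaarMeasure _ _
    refine measure_mono_null (t := L '' (Ioi (0 : ℝ) • (graphDiff u₁ u₂ '' Q))) ?_ (hac ?_)
    · rintro _ ⟨t, ht, _, ⟨e, ⟨x, hx, r, hr, hxr⟩, rfl⟩, rfl⟩
      refine ⟨(t / r) • graphDiff u₁ u₂ x, smul_mem_smul (div_pos ht.1 (by linarith))
        ⟨x, hx, rfl⟩, ?_⟩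
      rw [map_smul, hxr, smul_smul, div_mul_cancel₀ _ (by linarith)]
    · refine (L.toHomeomorph.measurableEmbedding.map_apply _ _).trans ?_
      refine measure_mono_null ?_
        (addHaar_cone_bitangentPairs μ hW₁ hW₂ h₁ h₂ hA₁ hA₂ hc₁ hc₂)
      exact (preimage_image_eq _ L.injective).subset
  rw [hnull, mul_zero]

end BitangentDirections

/-! ### Almost no direction is bitangent to an immersed hypersurface. -/

section BadDirections

variable {d : ℕ} {M : Type*} [TopologicalSpace M] [ChartedSpace (Euc d) M]

/-- The tangent space at `p` of an immersed hypersurface is contained in the graph of the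
differential of the function of which the hypersurface is locally a graph. -/
theorem inner_diffAt_of_graph {F : M → Euc (d + 1)} {p : M} {e : Euc (d + 1)}
    (hF : MDifferentiableAt (𝓡 d) 𝓘(ℝ, Euc (d + 1)) F p) {u : (ℝ ∙ e)ᗮ → ℝ}
    (hu : DifferentiableAt ℝ u (projPerp e (F p)))
    (hg : ∀ᶠ p' in 𝓝 p, ⟪e, F p'⟫ = u (projPerp e (F p'))) (v : Euc d) :
    ⟪e, diffAt (d := d) F p v⟫ =
      fderiv ℝ u (projPerp e (F p)) (projPerp e (diffAt (d := d) F p v)) := by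
  set φ := extChartAt (𝓡 d) p with hφ
  have h0 := hasFDerivAt_comp_extChartAt_symm hF
  have h1 : HasFDerivAt (fun x => ⟪e, (F ∘ φ.symm) x⟫) (innerSL ℝ e ∘L diffAt F p) (φ p) :=
    (innerSL ℝ e).hasFDerivAt.comp _ h0
  have h2 : HasFDerivAt (fun x => u (projPerp e ((F ∘ φ.symm) x)))
      (fderiv ℝ u (projPerp e (F p)) ∘L projPerp e ∘L diffAt F p) (φ p) := by
    refine HasFDerivAt.comp (φ p) (g := u) ?_ ((projPerp e).hasFDerivAt.comp _ h0)
    rw [Function.comp_apply, extChartAt_to_inv]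
    exact hu.hasFDerivAt
  have hev : (fun x => ⟪e, (F ∘ φ.symm) x⟫) =ᶠ[𝓝 (φ p)]
      fun x => u (projPerp e ((F ∘ φ.symm) x)) := by
    have := continuousAt_extChartAt_symm (I := 𝓡 d) p
    rw [ContinuousAt, extChartAt_to_inv] at this
    exact this.eventually hg
  exact congrArg (fun l : Euc d →L[ℝ] ℝ => l v) (h1.unique (h2.congr_of_eventuallyEq hev))

/-- The tangent space of a local graph projects onto the base. -/
theorem projPerp_diffAt_surjective {F : M → Euc (d + 1)} (hF : IsSmoothImmersion (d := d) F)
    {p : M} {e : Euc (d + 1)} (he : ‖e‖ = 1) {l : (ℝ ∙ e)ᗮ →L[ℝ] ℝ}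
    (hl : ∀ v, ⟪e, diffAt (d := d) F p v⟫ = l (projPerp e (diffAt (d := d) F p v))) :
    Function.Surjective (projPerp e ∘L diffAt (d := d) F p) := by
  have hinj : Function.Injective (projPerp e ∘L diffAt (d := d) F p).toLinearMap := by
    refine (injective_iff_map_eq_zero _).2 fun v hv => ?_
    have hv' : projPerp e (diffAt (d := d) F p v) = 0 := hv
    have h1 := projPerp_add_inner he (diffAt (d := d) F p v)
    rw [hl, hv', map_zero, zero_smul, ZeroMemClass.coe_zero, zero_add] at h1
    exact hF.2 p (h1.symm.trans (map_zero (diffAt (d := d) F p)).symm)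
  exact (LinearMap.injective_iff_surjective_of_finrank_eq_finrank
    (by rw [finrank_perp he]; simp)).1 hinj

theorem finrank_range_diffAt {k : ℕ} {F : M → Euc k} (hF : IsSmoothImmersion (d := d) F) (p : M) :
    Module.finrank ℝ (diffAt (d := d) F p).range = d := by
  have := LinearMap.finrank_range_of_inj (f := (diffAt (d := d) F p).toLinearMap) (hF.2 p)
  refine this.trans (by simp)

theorem exists_unit_notMem_range {F : M → Euc (d + 1)} (hF : IsSmoothImmersion (d := d) F)
    (p : M) : ∃ e : Euc (d + 1), ‖e‖ = 1 ∧ e ∉ (diffAt (d := d) F p).range := by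
  have hne : (diffAt (d := d) F p).range ≠ ⊤ := by
    intro h
    have := finrank_range_diffAt hF p
    rw [h, finrank_top] at this
    simp at this
  obtain ⟨x, hx⟩ : ∃ x, x ∉ (diffAt (d := d) F p).range := by
    by_contra! h
    exact hne (Submodule.eq_top_iff'.2 h)
  have hx0 : x ≠ 0 := by rintro rfl; exact hx (Submodule.zero_mem _)
  refine ⟨‖x‖⁻¹ • x, norm_smul_inv_norm hx0, fun h => hx ?_⟩
  have := Submodule.smul_mem _ ‖x‖ h
  rwa [smul_smul, mul_inv_cancel₀ (norm_ne_zero_iff.2 hx0), one_smul] at this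

/-- `p` and `q` lie on a line in direction `e` which is tangent to the hypersurface at both points,
with the same tangent hyperplane. -/
def IsBitangent (F : M → Euc (d + 1)) (e : Euc (d + 1)) (p q : M) : Prop :=
  (∃ r : ℝ, 0 < r ∧ F p - F q = r • e) ∧
    (diffAt (d := d) F p).range = (diffAt (d := d) F q).range ∧ e ∈ (diffAt (d := d) F p).range

/-- Splitting of `ℝᵈ⁺¹` along a unit vector. -/
noncomputable def perpProdEquiv {E : Type} [NormedAddCommGroup E] [InnerProductSpace ℝ E]
    [FiniteDimensional ℝ E] {e : E} (he : ‖e‖ = 1) : ((ℝ ∙ e)ᗮ × ℝ) ≃L[ℝ] E :=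
  LinearEquiv.toContinuousLinearEquiv
    { toFun := fun x => (x.1 : E) + x.2 • e
      map_add' := fun x y => by simp only [Prod.fst_add, Prod.snd_add, Submodule.coe_add]; module
      map_smul' := fun c x => by simp [smul_smul]
      invFun := fun x => (projPerp e x, ⟪e, x⟫)
      left_inv := fun x => Prod.ext (projPerp_coe_add_smul x.1 x.2) (inner_coe_add_smul he x.1 x.2)
      right_inv := fun x => projPerp_add_inner he x }

theorem perpProdEquiv_apply {E : Type} [NormedAddCommGroup E] [InnerProductSpace ℝ E]
    [FiniteDimensional ℝ E] {e : E} (he : ‖e‖ = 1) (x : (ℝ ∙ e)ᗮ × ℝ) :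
    perpProdEquiv he x = (x.1 : E) + x.2 • e := rfl

variable [IsManifold (𝓡 d) ∞ M]

/-- The tangent hyperplanes at `p₀` and `q₀` coincide, so a single `ν` is transverse to both, and
both sheets are graphs over the same space. This `ν` cannot be `e₀`, which is tangent. Nearby
bitangent pairs then give pairs in `bitangentPairs`, with separation at least `r₀ / 2`. -/
theorem exists_nhds_toSphere_bitangent {F : M → Euc (d + 1)} (hF : IsSmoothImmersion (d := d) F)
    {e₀ : Euc (d + 1)} {p₀ q₀ : M} (h₀ : IsBitangent F e₀ p₀ q₀) (he₀ : ‖e₀‖ = 1) :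
    ∃ N ∈ 𝓝 (p₀, q₀), (volume : Measure (Euc (d + 1))).toSphere
      {e | ∃ x ∈ N, IsBitangent F e x.1 x.2} = 0 := by
  obtain ⟨⟨r₀, hr₀, hr₀e⟩, hT, -⟩ := h₀
  obtain ⟨ν, hν, hνp⟩ := exists_unit_notMem_range hF p₀
  have hνq : ν ∉ (diffAt (d := d) F q₀).range := hT ▸ hνp
  obtain ⟨u₁, W₁, hW₁, hp₁, hs₁, -, hg₁⟩ := exists_graph hF hν hνp
  obtain ⟨u₂, W₂, hW₂, hp₂, hs₂, -, hg₂⟩ := exists_graph hF hν hνq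
  obtain ⟨ε₁, hε₁, hb₁⟩ := Metric.nhds_basis_closedBall.mem_iff.1 (hW₁.mem_nhds hp₁)
  obtain ⟨ε₂, hε₂, hb₂⟩ := Metric.nhds_basis_closedBall.mem_iff.1 (hW₂.mem_nhds hp₂)
  set A₁ := Metric.closedBall (projPerp ν (F p₀)) ε₁
  set A₂ := Metric.closedBall (projPerp ν (F q₀)) ε₂
  have hFc : Continuous F := hF.1.continuous
  have hPc : Continuous fun p => projPerp ν (F p) := (projPerp ν).continuous.comp hFc
  have n1 : ∀ᶠ x : M × M in 𝓝 (p₀, q₀), projPerp ν (F x.1) ∈ A₁ :=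
    (hPc.comp continuous_fst).continuousAt.eventually_mem (Metric.closedBall_mem_nhds _ hε₁)
  have n2 : ∀ᶠ x : M × M in 𝓝 (p₀, q₀), projPerp ν (F x.2) ∈ A₂ :=
    (hPc.comp continuous_snd).continuousAt.eventually_mem (Metric.closedBall_mem_nhds _ hε₂)
  have n3 : ∀ᶠ x : M × M in 𝓝 (p₀, q₀), ∀ᶠ p' in 𝓝 x.1, ⟪ν, F p'⟫ = u₁ (projPerp ν (F p')) :=
    (continuous_fst.tendsto (p₀, q₀)).eventually hg₁.eventually_nhds
  have n4 : ∀ᶠ x : M × M in 𝓝 (p₀, q₀), ∀ᶠ p' in 𝓝 x.2, ⟪ν, F p'⟫ = u₂ (projPerp ν (F p')) :=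
    (continuous_snd.tendsto (p₀, q₀)).eventually hg₂.eventually_nhds
  have n5 : ∀ᶠ x : M × M in 𝓝 (p₀, q₀), r₀ / 2 < ‖F x.1 - F x.2‖ := by
    refine (((hFc.comp continuous_fst).sub
      (hFc.comp continuous_snd)).norm.continuousAt).eventually_const_lt ?_
    change _ < ‖F p₀ - F q₀‖
    rw [hr₀e, norm_smul, he₀, Real.norm_of_nonneg hr₀.le]
    linarith
  refine ⟨_, (((n1.and n2).and n3).and n4).and n5, measure_mono_null ?_
    (toSphere_bitangentPairs (perpProdEquiv hν) hW₁ hW₂ hs₁ hs₂ hb₁ hb₂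
      (isCompact_closedBall _ _) (isCompact_closedBall _ _) (half_pos hr₀))⟩
  rintro e ⟨⟨p, q⟩, ⟨⟨⟨⟨hp, hq⟩, hgp⟩, hgq⟩, hpq⟩, ⟨r, hr, hre⟩, hTpq, v, hv⟩
  simp only at hp hq hgp hgq hpq hre hTpq hv
  have hv : diffAt (d := d) F p v = (e : Euc (d + 1)) := hv
  have hd₁ : DifferentiableAt ℝ u₁ (projPerp ν (F p)) :=
    (hs₁.contDiffAt (hW₁.mem_nhds (hb₁ hp))).differentiableAt (by simp)
  have hd₂ : DifferentiableAt ℝ u₂ (projPerp ν (F q)) :=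
    (hs₂.contDiffAt (hW₂.mem_nhds (hb₂ hq))).differentiableAt (by simp)
  have t₁ := inner_diffAt_of_graph (hF.1.mdifferentiable (by simp) p) hd₁ hgp
  have t₂ := inner_diffAt_of_graph (hF.1.mdifferentiable (by simp) q) hd₂ hgq
  have en : ‖(e : Euc (d + 1))‖ = 1 := by simp
  have ep := hgp.self_of_nhds
  have eq := hgq.self_of_nhds
  refine ⟨(projPerp ν (F p), projPerp ν (F q)), ⟨hp, hq, ?_, ?_⟩, r, ?_, ?_⟩
  -- The tangent space projects onto the base, so equal tangent spaces force equal differentials.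
  · ext z
    obtain ⟨w, rfl⟩ := projPerp_diffAt_surjective hF hν t₁ z
    obtain ⟨w', hw'⟩ : diffAt (d := d) F p w ∈ (diffAt (d := d) F q).range := hTpq ▸ ⟨w, rfl⟩
    have hw' : diffAt (d := d) F q w' = diffAt (d := d) F p w := hw'
    refine (t₁ w).symm.trans ?_
    rw [← hw', t₂ w', hw']
    rfl
  · change u₁ (projPerp ν (F p)) - u₂ (projPerp ν (F q)) =
      fderiv ℝ u₁ (projPerp ν (F p)) (projPerp ν (F p) - projPerp ν (F q))
    -- The chord `F p - F q = r • e` is itself a tangent vector, so its `ν`-component is given by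
    -- the differential of `u₁`.
    rw [← ep, ← eq, ← inner_sub_right, ← map_sub, hre, ← hv, ← map_smul, t₁]
  · rw [hre, norm_smul, en, mul_one, Real.norm_of_nonneg hr.le] at hpq
    exact hpq.le
  · rw [perpProdEquiv_apply]
    change ((projPerp ν (F p) - projPerp ν (F q) : (ℝ ∙ ν)ᗮ) : Euc (d + 1)) +
      (u₁ (projPerp ν (F p)) - u₂ (projPerp ν (F q))) • ν = _
    rw [← ep, ← eq, ← inner_sub_right, ← map_sub, projPerp_add_inner hν, hre]

/-- Almost no direction is bitangent to an immersed hypersurface. -/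
theorem toSphere_bitangent [SecondCountableTopology M] {F : M → Euc (d + 1)}
    (hF : IsSmoothImmersion (d := d) F) :
    (volume : Measure (Euc (d + 1))).toSphere {e | ∃ p q, IsBitangent F e p q} = 0 := by
  let B : Set (M × M) := {x | ∃ e : Euc (d + 1), ‖e‖ = 1 ∧ IsBitangent F e x.1 x.2}
  have hB : ∀ x ∈ B, ∃ N ∈ 𝓝[B] x, (volume : Measure (Euc (d + 1))).toSphere
      {e | ∃ x ∈ N, IsBitangent F e x.1 x.2} = 0 := by
    rintro x ⟨e, he, hx⟩
    obtain ⟨N, hN, hN'⟩ := exists_nhds_toSphere_bitangent hF hx he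
    exact ⟨N, mem_nhdsWithin_of_mem_nhds hN, hN'⟩
  -- Second countability of `M × M` reduces the local null sets to countably many.
  choose! N hN hN' using hB
  obtain ⟨t, htB, ht, hcov⟩ := TopologicalSpace.countable_cover_nhdsWithin hN
  refine measure_mono_null ?_ ((measure_biUnion_null_iff ht).2 fun x hx => hN' x (htB hx))
  rintro e ⟨p, q, hpq⟩
  have hmem : (p, q) ∈ B := ⟨e, by simp, hpq⟩
  obtain ⟨x, hx, hpx⟩ := mem_iUnion₂.1 (hcov hmem)
  exact mem_iUnion₂.2 ⟨x, hx, (p, q), hpx, hpq⟩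

end BadDirections

/-! ### The two pieces, their ends, and the attained least gap. -/

section Separation

theorem isConnected_of_mem_componentsOf {T : Type*} [TopologicalSpace T] {X C : Set T}
    (hC : C ∈ componentsOf X) : IsConnected C ∧ C ⊆ X ∧ closure C ∩ X ⊆ C := by
  obtain ⟨x, hx, rfl⟩ := hC
  refine ⟨isConnected_connectedComponentIn_iff.2 hx, connectedComponentIn_subset X x, ?_⟩
  refine IsPreconnected.subset_connectedComponentIn ?_
    ⟨subset_closure (mem_connectedComponentIn hx), hx⟩ inter_subset_right
  exact isPreconnected_connectedComponentIn.subset_closure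
    (subset_inter subset_closure (connectedComponentIn_subset X x)) inter_subset_left

theorem disjoint_of_mem_componentsOf {T : Type*} [TopologicalSpace T] {X C C' : Set T}
    (hC : C ∈ componentsOf X) (hC' : C' ∈ componentsOf X) (hne : C ≠ C') : Disjoint C C' := by
  obtain ⟨x, hx, rfl⟩ := hC
  obtain ⟨y, hy, rfl⟩ := hC'
  refine Set.disjoint_left.2 fun z hz hz' => hne ?_
  rw [connectedComponentIn_eq hz, connectedComponentIn_eq hz']

/-- `Sp` and `Sm` are two nonempty connected pieces into which the bounded set `Γ` separates
the closed set `S`. -/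
structure IsSeparation {E : Type*} [NormedAddCommGroup E] (S Γ Sp Sm : Set E) : Prop where
  isClosed : IsClosed S
  isClosed_sep : IsClosed Γ
  isBounded_sep : Bornology.IsBounded Γ
  union_eq : Sp ∪ Sm = S \ Γ
  disjoint : Disjoint Sp Sm
  connected_left : IsConnected Sp
  connected_right : IsConnected Sm
  closure_left : closure Sp ⊆ Sp ∪ Γ
  closure_right : closure Sm ⊆ Sm ∪ Γ
  subset_closure : S ⊆ closure (S \ Γ)

namespace IsSeparation

variable {E : Type*} [NormedAddCommGroup E] {S Γ Sp Sm : Set E}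

/-- A component is relatively closed in `S \ Γ` and `S` is closed, so taking the closure of a piece
adds only points of `Γ`. -/
theorem of_componentsOf (hS : IsClosed S) (hΓ : IsCompact Γ)
    (hd : S ⊆ closure (S \ Γ)) (hne : Sp ≠ Sm) (hc : componentsOf (S \ Γ) = {Sp, Sm}) :
    IsSeparation S Γ Sp Sm := by
  have hp : Sp ∈ componentsOf (S \ Γ) := hc ▸ mem_insert Sp {Sm}
  have hm : Sm ∈ componentsOf (S \ Γ) := hc ▸ mem_insert_of_mem Sp rfl
  obtain ⟨cp, sp, clp⟩ := isConnected_of_mem_componentsOf hp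
  obtain ⟨cm, sm, clm⟩ := isConnected_of_mem_componentsOf hm
  have aux : ∀ C, C ⊆ S \ Γ → closure C ∩ (S \ Γ) ⊆ C → closure C ⊆ C ∪ Γ := by
    intro C h1 h2 x hx
    by_cases hxΓ : x ∈ Γ
    · exact Or.inr hxΓ
    · exact Or.inl (h2 ⟨hx, hS.closure_subset_iff.2 (h1.trans sdiff_subset) hx, hxΓ⟩)
  refine ⟨hS, hΓ.isClosed, hΓ.isBounded, Subset.antisymm (union_subset sp sm) fun x hx => ?_,
    disjoint_of_mem_componentsOf hp hm hne, cp, cm, aux _ sp clp, aux _ sm clm, hd⟩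
  have : connectedComponentIn (S \ Γ) x ∈ ({Sp, Sm} : Set (Set E)) := hc ▸ ⟨x, hx, rfl⟩
  rcases this with h | h
  · exact Or.inl (h ▸ mem_connectedComponentIn hx)
  · exact Or.inr (h ▸ mem_connectedComponentIn hx)

theorem symm (h : IsSeparation S Γ Sp Sm) : IsSeparation S Γ Sm Sp :=
  ⟨h.isClosed, h.isClosed_sep, h.isBounded_sep, union_comm Sp Sm ▸ h.union_eq, h.disjoint.symm,
    h.connected_right, h.connected_left, h.closure_right, h.closure_left, h.subset_closure⟩

theorem left_subset (h : IsSeparation S Γ Sp Sm) : Sp ⊆ S \ Γ := h.union_eq ▸ subset_union_left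

theorem disjoint_closure_left (h : IsSeparation S Γ Sp Sm) : Disjoint (closure Sp) Sm := by
  refine Set.disjoint_left.2 fun x hx hxm => ?_
  rcases h.closure_left hx with h' | h'
  · exact Set.disjoint_left.1 h.disjoint h' hxm
  · exact (h.symm.left_subset hxm).2 h'

theorem isOpen_left (h : IsSeparation S Γ Sp Sm) : IsOpen ((↑) ⁻¹' Sp : Set S) := by
  have : ((↑) ⁻¹' Sp : Set S) = ((↑) ⁻¹' (closure Sm ∪ Γ))ᶜ := by
    ext x
    constructor
    · rintro hx (h' | h')
      · exact Set.disjoint_left.1 h.symm.disjoint_closure_left h' hx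
      · exact (h.left_subset hx).2 h'
    · intro hx
      have : (x : E) ∈ Sp ∪ Sm := h.union_eq ▸ ⟨x.2, fun h' => hx (Or.inr h')⟩
      exact this.resolve_right fun h' => hx (Or.inl (_root_.subset_closure h'))
  rw [this]
  exact ((isClosed_closure.union h.isClosed_sep).preimage continuous_subtype_val).isOpen_compl

theorem image_left (h : IsSeparation S Γ Sp Sm) :
    Subtype.val '' ((↑) ⁻¹' Sp : Set S) = Sp := by
  rw [Subtype.image_preimage_coe]
  exact inter_eq_right.2 (h.left_subset.trans sdiff_subset)

theorem eventually_mem_left (h : IsSeparation S Γ Sp Sm) {x : E} (hx : x ∈ Sp) :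
    ∀ᶠ y in 𝓝 x, y ∈ S → y ∈ Sp := by
  have hxS : x ∈ S := (h.left_subset hx).1
  have := h.isOpen_left.mem_nhds (show (⟨x, hxS⟩ : S) ∈ ((↑) ⁻¹' Sp : Set S) from hx)
  rw [mem_nhds_subtype] at this
  obtain ⟨u, hu, hu'⟩ := this
  filter_upwards [hu] with y hy hyS
  exact hu' (show (⟨y, hyS⟩ : S) ∈ ((↑) ⁻¹' u : Set S) from hy)

theorem isConnected_left (h : IsSeparation S Γ Sp Sm) : IsConnected ((↑) ⁻¹' Sp : Set S) := by
  have := h.connected_left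
  rw [← h.image_left] at this
  exact ⟨this.nonempty.of_image,
    Topology.IsInducing.subtypeVal.isPreconnected_image.1 this.isPreconnected⟩

theorem mem_closure_left (h : IsSeparation S Γ Sp Sm) (x : S) :
    x ∈ closure ((↑) ⁻¹' Sp : Set S) ↔ (x : E) ∈ closure Sp := by
  rw [closure_subtype, h.image_left]

/-- Density of `S \ Γ` in `S` makes the two closures cover `S`; a point outside the closure of `Sm`
is then interior to the closure of `Sp`. -/
theorem frontier_left (h : IsSeparation S Γ Sp Sm) :
    frontier (closure ((↑) ⁻¹' Sp : Set S)) =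
      closure ((↑) ⁻¹' Sp : Set S) ∩ closure ((↑) ⁻¹' Sm : Set S) := by
  rw [frontier, closure_closure, sdiff_eq]
  congr 1
  rw [compl_eq_comm]
  refine Subset.antisymm (interior_maximal (fun x hx => ?_) isClosed_closure.isOpen_compl) ?_
  · have hx' : (x : E) ∈ closure Sp ∪ closure Sm := by
      rw [← closure_union, h.union_eq]
      exact h.subset_closure x.2
    refine (h.mem_closure_left x).2 (hx'.resolve_right fun h' => hx ?_)
    exact (h.symm.mem_closure_left x).2 h'
  · refine fun x hx hxm => ?_
    have d1 : Disjoint (closure ((↑) ⁻¹' Sp : Set S)) ((↑) ⁻¹' Sm) :=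
      (h.disjoint.preimage _).closure_left h.symm.isOpen_left
    exact Set.disjoint_left.1 ((d1.mono_left interior_subset).closure_right isOpen_interior) hx hxm

end IsSeparation

/-- If the ends are separated, pairs of points of the two pieces at bounded distance stay in a
bounded region. -/
theorem HasSeparatedEnds.norm_le_of_norm_sub_le {k : ℕ} {δ : ℝ} (hδ : 0 < δ)
    {S Γ Sp Sm : Set (Euc k)} (hs : HasSeparatedEnds δ S) (h : IsSeparation S Γ Sp Sm) (D : ℝ) :
    ∃ R : ℝ, ∀ x ∈ Sp, ∀ y ∈ Sm, ‖x - y‖ ≤ D → ‖x‖ ≤ R := by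
  have key := hs ((↑) ⁻¹' Sp) ((↑) ⁻¹' Sm) h.isOpen_left h.symm.isOpen_left h.isConnected_left
    h.symm.isConnected_left (h.disjoint.preimage _) ?_ ?_ ?_
  · rw [h.image_left, h.symm.image_left] at key
    obtain ⟨r, hr, hr0, hrD⟩ := (key.and ((eventually_gt_atTop 0).and
      (eventually_gt_atTop (D / δ)))).exists
    -- If `‖x‖ > r + D`, then `‖y‖ ≥ r` as well, so both rescaled points lie outside the unit ball.
    -- They are at distance at most `D / r`, which is less than `δ` as `r > D / δ`.
    refine ⟨r + D, fun x hx y hy hxy => ?_⟩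
    by_contra! hlt
    have hD : 0 ≤ D := (norm_nonneg _).trans hxy
    have far : ∀ z : Euc k, r ≤ ‖z‖ → r⁻¹ • z ∉ Metric.ball (0 : Euc k) 1 := by
      intro z hz hz'
      rw [mem_ball_zero_iff, norm_smul, norm_inv, Real.norm_of_nonneg hr0.le,
        inv_mul_lt_iff₀ hr0, mul_one] at hz'
      linarith
    have hy' : r ≤ ‖y‖ := by
      have := norm_sub_norm_le x y
      linarith
    have mx := mem_sdiff_of_mem (smul_mem_smul_set (a := r⁻¹) hx) (far x (by linarith))
    have my := mem_sdiff_of_mem (smul_mem_smul_set (a := r⁻¹) hy) (far y hy')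
    rcases hr with hr | hr | hr
    · rw [hr] at mx; exact mx
    · rw [hr] at my; exact my
    · have := hr _ mx _ my
      rw [← smul_sub, norm_smul, norm_inv, Real.norm_of_nonneg hr0.le,
        le_inv_mul_iff₀ hr0] at this
      rw [div_lt_iff₀ hδ] at hrD
      linarith
  · refine eq_univ_of_forall fun x => ?_
    have hx' : (x : Euc k) ∈ closure Sp ∪ closure Sm := by
      rw [← closure_union, h.union_eq]
      exact h.subset_closure x.2
    exact hx'.imp (h.mem_closure_left x).2 (h.symm.mem_closure_left x).2
  · rw [h.frontier_left, h.symm.frontier_left, inter_comm]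
  · rw [h.frontier_left, ← Bornology.isBounded_image_subtype_val]
    refine h.isBounded_sep.subset ?_
    rintro _ ⟨x, ⟨h1, h2⟩, rfl⟩
    rw [h.mem_closure_left] at h1
    rw [h.symm.mem_closure_left] at h2
    refine (h.closure_right h2).resolve_left fun h' => ?_
    exact Set.disjoint_left.1 h.disjoint_closure_left h1 h'

/-- Under the ordering conditions in direction `e`, the least height of a point of `Sm`
above a point of `Sp` is attained. -/
theorem IsSeparation.exists_min_height {E : Type*} [NormedAddCommGroup E] [NormedSpace ℝ E]
    [ProperSpace E] {S Γ Sp Sm O : Set E} (h : IsSeparation S Γ Sp Sm) {e : E} (he : ‖e‖ = 1)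
    (hbd : ∀ D : ℝ, ∃ R : ℝ, ∀ x ∈ Sp, ∀ y ∈ Sm, ‖x - y‖ ≤ D → ‖x‖ ≤ R)
    (h1 : ∃ y ∈ Sp, ∃ s : ℝ, 0 < s ∧ y + s • e ∈ Sm)
    (hO : IsOpen O) (hΓO : Γ ⊆ O)
    (h2 : ∀ a ∈ O ∩ closure Sm, ∃ t : ℝ, 0 < t ∧ a - t • e ∈ Sm ∧
      ∀ t', 0 < t' → t' < t → a - t' • e ∉ Sp)
    (h3 : ∀ z ∈ Γ, ∀ s : ℝ, 0 < s → z + s • e ∈ Sm → ∃ s', 0 < s' ∧ s' < s ∧ z + s' • e ∈ Sp) :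
    ∃ y ∈ Sp, ∃ s : ℝ, 0 < s ∧ y + s • e ∈ Sm ∧
      ∀ y' ∈ Sp, ∀ s', 0 < s' → y' + s' • e ∈ Sm → s ≤ s' := by
  -- Take the lowest point of `closure Sm` above `y`. If it lay in `O`, `h2` would give a point of
  -- `Sm` beneath it: above `y` this contradicts minimality, at `y` it contradicts disjointness, and
  -- below `y` the point `y` itself lies strictly between.
  have lower : ∀ y ∈ Sp, ∀ s : ℝ, 0 < s → y + s • e ∈ Sm →
      ∃ s', 0 < s' ∧ s' ≤ s ∧ y + s' • e ∈ Sm \ O := by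
    intro y hy s hs hys
    have hcl : IsCompact (Icc 0 s ∩ (fun t : ℝ => y + t • e) ⁻¹' closure Sm) :=
      isCompact_Icc.inter_right (isClosed_closure.preimage (by fun_prop))
    obtain ⟨t, ⟨⟨ht0, hts⟩, htm⟩, hmin⟩ := hcl.exists_isLeast
      ⟨s, ⟨hs.le, le_rfl⟩, _root_.subset_closure hys⟩
    have htm : y + t • e ∈ closure Sm := htm
    have hy' : y ∉ closure Sm := fun h' =>
      Set.disjoint_left.1 h.symm.disjoint_closure_left h' hy
    have htpos : 0 < t := by
      refine lt_of_le_of_ne ht0 fun h0 => hy' ?_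
      rwa [← h0, zero_smul, add_zero] at htm
    have hnO : y + t • e ∉ O := by
      intro hO'
      obtain ⟨τ, hτ, hτm, hτp⟩ := h2 _ ⟨hO', htm⟩
      rcases lt_trichotomy τ t with hlt | heq | hgt
      · have e1 : y + t • e - τ • e = y + (t - τ) • e := by rw [sub_smul]; abel
        rw [e1] at hτm
        have := hmin ⟨⟨by linarith, by linarith⟩, _root_.subset_closure hτm⟩
        linarith
      · rw [heq, add_sub_cancel_right] at hτm
        exact hy' (_root_.subset_closure hτm)
      · exact hτp t htpos hgt (by rwa [add_sub_cancel_right])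
    exact ⟨t, htpos, hts, (h.closure_right htm).resolve_right fun h' => hnO (hΓO h'), hnO⟩
  obtain ⟨y₀, hy₀, s₀, hs₀, hys₀⟩ := h1
  -- Removing the open set `O` keeps the upper points in `Sm` under limits; `hbd` and the bound on
  -- `Γ` make `K` compact.
  let K : Set (E × ℝ) := {x | x.1 ∈ closure Sp ∧ x.2 ∈ Icc 0 s₀ ∧ x.1 + x.2 • e ∈ closure Sm \ O}
  have hKcl : IsClosed K := by
    refine (isClosed_closure.preimage continuous_fst).inter
      ((isClosed_Icc.preimage continuous_snd).inter ?_)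
    exact (isClosed_closure.sdiff hO).preimage (by fun_prop)
  have memSm : ∀ x ∈ closure Sm \ O, x ∈ Sm := fun x hx =>
    (h.closure_right hx.1).resolve_right fun h' => hx.2 (hΓO h')
  have hKc : IsCompact K := by
    obtain ⟨R, hR⟩ := hbd s₀
    obtain ⟨R', hR'⟩ := h.isBounded_sep.exists_norm_le
    refine ((isCompact_closedBall (0 : E) (max R R')).prod (isCompact_Icc (a := 0) (b := s₀))
      ).of_isClosed_subset hKcl ?_
    rintro ⟨y, s⟩ ⟨hy, hs, hys⟩
    refine ⟨mem_closedBall_zero_iff.2 ?_, hs⟩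
    rcases h.closure_left hy with hy | hy
    · refine (hR y hy _ (memSm _ hys) ?_).trans (le_max_left _ _)
      simp only [sub_add_cancel_left, norm_neg, norm_smul, he, mul_one]
      rw [Real.norm_of_nonneg hs.1]
      exact hs.2
    · exact (hR' y hy).trans (le_max_right _ _)
  have inK : ∀ y ∈ Sp, ∀ s : ℝ, 0 < s → s ≤ s₀ → y + s • e ∈ Sm → ∃ s' ≤ s, (y, s') ∈ K := by
    intro y hy s hs hss hys
    obtain ⟨s', hs'0, hs's, hs'⟩ := lower y hy s hs hys
    exact ⟨s', hs's, _root_.subset_closure hy, ⟨hs'0.le, hs's.trans hss⟩, _root_.subset_closure hs'.1, hs'.2⟩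
  obtain ⟨s₁, -, hs₁⟩ := inK y₀ hy₀ s₀ hs₀ le_rfl hys₀
  obtain ⟨⟨y, s⟩, ⟨hy, hs, hys⟩, hmin⟩ := hKc.exists_isMinOn ⟨_, hs₁⟩ continuous_snd.continuousOn
  have hysm := memSm _ hys
  simp only at hy hs hys hysm
  have hspos : 0 < s := by
    refine lt_of_le_of_ne hs.1 fun h0 => ?_
    rw [← h0, zero_smul, add_zero] at hysm
    exact Set.disjoint_left.1 h.disjoint_closure_left hy hysm
  have hle : ∀ y' ∈ Sp, ∀ s', 0 < s' → y' + s' • e ∈ Sm → s ≤ s' := by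
    intro y' hy' s' hs' hys'
    rcases le_or_gt s' s₀ with hle | hgt
    · obtain ⟨s'', hs'', hK⟩ := inK y' hy' s' hs' hle hys'
      exact (hmin hK).trans hs''
    · exact hs.2.trans hgt.le
  refine ⟨y, (h.closure_left hy).resolve_right fun hyΓ => ?_, s, hspos, hysm, hle⟩
  -- If the lower point were in `Γ`, a point of `Sp` strictly between would give the smaller gap `s
  -- - s'`.
  obtain ⟨s', hs'0, hs's, hs'⟩ := h3 y hyΓ s hspos hysm
  have := hle _ hs' (s - s') (by linarith) (by
    rwa [add_assoc, ← add_smul, add_sub_cancel])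
  linarith

end Separation

/-! ### The separating sphere is nowhere dense in the hypersurface, by Hausdorff dimension. -/

section Density

variable {d k : ℕ} {M : Type*} [TopologicalSpace M] [ChartedSpace (Euc d) M]
  [IsManifold (𝓡 d) ∞ M]

theorem dimH_range_le_of_contMDiff [SecondCountableTopology M] {F : M → Euc k}
    (hF : ContMDiff (𝓡 d) 𝓘(ℝ, Euc k) ∞ F) : dimH (range F) ≤ d := by
  have hloc : ∀ p : M, ∃ N ∈ 𝓝 p, dimH (F '' N) ≤ d := by
    intro p
    obtain ⟨ε, hε, hb⟩ := Metric.isOpen_iff.1 (isOpen_extChartAt_target (I := 𝓡 d) p) _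
      (mem_extChartAt_target p)
    refine ⟨_, inter_mem (extChartAt_source_mem_nhds (I := 𝓡 d) p)
      ((continuousAt_extChartAt (I := 𝓡 d) p).preimage_mem_nhds (Metric.ball_mem_nhds _ hε)), ?_⟩
    have hdim := ((contDiffOn_comp_extChartAt_symm hF p).mono hb).of_le
      (m := 1) (by simp) |>.dimH_image_le (convex_ball _ _) Subset.rfl
    refine (dimH_mono ?_).trans (hdim.trans ?_)
    · rintro _ ⟨q, ⟨hq, hq'⟩, rfl⟩
      exact ⟨_, hq', congrArg F ((extChartAt (𝓡 d) p).left_inv hq)⟩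
    · refine (dimH_mono (subset_univ _)).trans ?_
      rw [Real.dimH_univ_eq_finrank]
      simp
  choose N hN hNd using hloc
  obtain ⟨t, ht, hcov⟩ := TopologicalSpace.countable_cover_nhds hN
  have : range F ⊆ ⋃ p ∈ t, F '' N p := by
    rintro _ ⟨q, rfl⟩
    obtain ⟨p, hp, hq⟩ := mem_iUnion₂.1 (hcov ▸ mem_univ q)
    exact mem_iUnion₂.2 ⟨p, hp, q, hq, rfl⟩
  refine (dimH_mono this).trans ?_
  rw [dimH_bUnion ht]
  exact iSup₂_le fun p _ => hNd p

/-- If `Γ` contained all points of the hypersurface near `F p`, its projection along a transverse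
`ν` would contain an open subset of a `d`-dimensional space, but Lipschitz maps do not raise
Hausdorff dimension. -/
theorem range_subset_closure_sdiff {F : M → Euc (d + 1)} (hF : IsSmoothImmersion (d := d) F)
    {Γ : Set (Euc (d + 1))} (hΓ : dimH Γ < d) : range F ⊆ closure (range F \ Γ) := by
  rintro _ ⟨p, rfl⟩
  by_contra hp
  rw [mem_closure_iff_nhds] at hp
  push Not at hp
  obtain ⟨G, hG, hGe⟩ := hp
  obtain ⟨ν, hν, hνp⟩ := exists_unit_notMem_range hF p
  obtain ⟨u, -, -, -, -, hu, -⟩ := exists_graph hF hν hνp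
  have hO : F ⁻¹' G ∈ 𝓝 p := hF.1.continuous.continuousAt.preimage_mem_nhds hG
  have hmem : projPerp ν '' Γ ∈ 𝓝 (projPerp ν (F p)) := by
    filter_upwards [hu _ hO] with z hz
    obtain ⟨q, hq, hqz⟩ := hz
    refine ⟨F q, ?_, by rw [hqz, projPerp_coe_add_smul]⟩
    by_contra hqΓ
    exact (hGe ▸ ⟨hq, ⟨q, rfl⟩, hqΓ⟩ : F q ∈ (∅ : Set (Euc (d + 1))))
  have h1 := Real.dimH_of_mem_nhds hmem
  rw [finrank_perp hν] at h1
  have h2 : dimH (projPerp ν '' Γ) ≤ dimH Γ := (projPerp ν).lipschitz.dimH_image_le Γ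
  rw [h1] at h2
  exact absurd (h2.trans_lt hΓ) (lt_irrefl _)

end Density

/-! ### From the coordinate form of the ordering conditions to translations along the last basis
vector. -/

section Coordinates

variable {n : ℕ} (b : OrthonormalBasis (Fin (n + 1)) ℝ (Euc (n + 1)))

theorem SameVertical.eq_add_smul {x y : Euc (n + 1)} (h : SameVertical b x y) :
    x = y + (height b x - height b y) • b (Fin.last n) := by
  apply b.repr.injective
  ext i
  refine Fin.lastCases ?_ (fun i => ?_) i
  · simp [height]
  · simpa [Fin.castSucc_ne_last, (Fin.castSucc_lt_last i).ne] using h i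

theorem sameVertical_add_smul (y : Euc (n + 1)) (s : ℝ) :
    SameVertical b (y + s • b (Fin.last n)) y := fun i => by
  simp [(Fin.castSucc_lt_last i).ne]

theorem SameVertical.symm {x y : Euc (n + 1)} (h : SameVertical b x y) : SameVertical b y x :=
  fun i => (h i).symm

theorem height_add_smul (y : Euc (n + 1)) (s : ℝ) :
    height b (y + s • b (Fin.last n)) = height b y + s := by
  simp [height]

theorem exists_orthonormalBasis_last {e : Euc (n + 1)} (he : ‖e‖ = 1) :
    ∃ b : OrthonormalBasis (Fin (n + 1)) ℝ (Euc (n + 1)), b (Fin.last n) = e := by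
  have ho : Orthonormal ℝ (({Fin.last n} : Set (Fin (n + 1))).domRestrict fun _ => e) := by
    refine ⟨fun _ => he, fun i j hij => ?_⟩
    exact absurd (Subsingleton.elim i j) hij
  obtain ⟨b, hb⟩ := ho.exists_orthonormalBasis_extension_of_card_eq (by simp)
  exact ⟨b, hb _ rfl⟩

theorem GraphOrdering.exists_min_height {S Γ Sp Sm : Set (Euc (n + 1))}
    (hb : GraphOrdering b Γ Sp Sm) (h : IsSeparation S Γ Sp Sm)
    (hbd : ∀ D : ℝ, ∃ R : ℝ, ∀ x ∈ Sp, ∀ y ∈ Sm, ‖x - y‖ ≤ D → ‖x‖ ≤ R) :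
    ∃ y ∈ Sp, ∃ s : ℝ, 0 < s ∧ y + s • b (Fin.last n) ∈ Sm ∧
      ∀ y' ∈ Sp, ∀ s', 0 < s' → y' + s' • b (Fin.last n) ∈ Sm → s ≤ s' := by
  obtain ⟨V, -, ⟨O, hO, hΓO, hOV⟩, hV⟩ := hb.near_boundary
  refine h.exists_min_height (b.norm_eq_one _) hbd ?_ hO hΓO (fun a ha => ?_)
    (fun z hz s hs hzs => ?_)
  · obtain ⟨x, hx, y, hy, hxy, hlt⟩ := hb.exists_above
    exact ⟨y, hy, height b x - height b y, sub_pos.2 hlt, by rwa [← hxy.eq_add_smul]⟩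
  · obtain ⟨u, hu, hau, hlt, hno⟩ := hV a (hOV ha)
    have e1 : a - (height b a - height b u) • b (Fin.last n) = u := by
      rw [sub_eq_iff_eq_add]
      exact hau.eq_add_smul
    refine ⟨height b a - height b u, sub_pos.2 hlt, by rwa [e1], fun t ht htlt hmem => hno ?_⟩
    rw [sub_eq_add_neg, ← neg_smul] at hmem
    refine ⟨_, hmem, (sameVertical_add_smul b a (-t)).symm, ?_, ?_⟩ <;>
      rw [height_add_smul] <;> linarith
  · obtain ⟨w, hw, hzw, h1, h2⟩ := hb.above_boundary z hz _ hzs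
      (sameVertical_add_smul b z s).symm (by rw [height_add_smul]; linarith)
    rw [height_add_smul] at h1
    refine ⟨height b w - height b z, by linarith, by linarith, ?_⟩
    rwa [← (hzw.symm).eq_add_smul]

end Coordinates

/-! ### Second-order condition at a minimum, and traces in arbitrary frames. -/

section SecondOrder

/-- Restrict to the line in direction `a`. A negative second derivative would make the minimum also
a local maximum, so the restriction would be locally constant and its second derivative zero. -/
theorem IsLocalMin.fderiv_fderiv_nonneg {V : Type*} [NormedAddCommGroup V] [NormedSpace ℝ V]
    {f : V → ℝ} {z : V} (hmin : IsLocalMin f z) (hf : ContDiffAt ℝ 2 f z) (a : V) :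
    0 ≤ fderiv ℝ (fderiv ℝ f) z a a := by
  by_contra! hneg
  set l : ℝ → V := fun t => z + t • a with hl
  have hl0 : l 0 = z := by simp [hl]
  have hlc : Continuous l := by fun_prop
  have hld : ∀ t, HasDerivAt l a t := fun t => by
    simpa [hl] using ((hasDerivAt_id t).smul_const a).const_add z
  have htend : Tendsto l (𝓝 0) (𝓝 z) := hl0 ▸ hlc.tendsto 0
  have hdiff : ∀ᶠ t in 𝓝 (0 : ℝ), ContDiffAt ℝ 2 f (l t) :=
    htend.eventually (hf.eventually (by simp))
  have hd1 : deriv (f ∘ l) =ᶠ[𝓝 0] fun t => fderiv ℝ f (l t) a := by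
    filter_upwards [hdiff] with t ht
    exact ((ht.differentiableAt (by simp)).hasFDerivAt.comp_hasDerivAt t (hld t)).deriv
  have hd2 : HasDerivAt (fun t => fderiv ℝ f (l t) a) (fderiv ℝ (fderiv ℝ f) z a a) 0 := by
    have h1 : HasFDerivAt (fderiv ℝ f) (fderiv ℝ (fderiv ℝ f) z) (l 0) := by
      rw [hl0]
      exact ((hf.fderiv_right (m := 1) (by norm_num)).differentiableAt (by simp)).hasFDerivAt
    simpa using (h1.comp_hasDerivAt 0 (hld 0)).clm_apply (hasDerivAt_const 0 a)
  have hdd : deriv (deriv (f ∘ l)) 0 = fderiv ℝ (fderiv ℝ f) z a a := by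
    rw [hd1.deriv_eq, hd2.deriv]
  have hminl : IsLocalMin (f ∘ l) 0 := by
    have := htend.eventually hmin
    filter_upwards [this] with t ht
    simpa [hl0] using ht
  have hcont : ContinuousAt (f ∘ l) 0 :=
    ContinuousAt.comp (hl0.symm ▸ hf.continuousAt) hlc.continuousAt
  have hmaxl : IsLocalMax (f ∘ l) 0 :=
    isLocalMax_of_deriv_deriv_neg (hdd ▸ hneg) hminl.deriv_eq_zero hcont
  have hconst : f ∘ l =ᶠ[𝓝 0] fun _ => (f ∘ l) 0 := by
    filter_upwards [hminl, hmaxl] with t h1 h2 using le_antisymm h2 h1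
  have : deriv (deriv (f ∘ l)) 0 = 0 := by
    have h1 : deriv (f ∘ l) =ᶠ[𝓝 0] fun _ => 0 := by
      filter_upwards [hconst.eventually_nhds] with t ht
      rw [EventuallyEq.deriv_eq ht, deriv_const]
    rw [h1.deriv_eq, deriv_const]
  linarith

/-- The trace of a bilinear form in terms of a frame equals its trace in an orthonormal frame. -/
theorem sum_gram_inv_eq_sum_orthonormal {d : ℕ} {E : Type*} [NormedAddCommGroup E]
    [InnerProductSpace ℝ E] {v w : Fin d → E} (hw : Orthonormal ℝ w)
    (A : Matrix (Fin d) (Fin d) ℝ) (hA : ∀ j, w j = ∑ k, A k j • v k) (B : E →L[ℝ] E →L[ℝ] ℝ) :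
    ∑ i, ∑ j, (Matrix.gram ℝ v)⁻¹ i j * B (v j) (v i) = ∑ k, B (w k) (w k) := by
  -- Orthonormality of `w` reads `Aᵀ G A = 1`, whence `G⁻¹ = A Aᵀ`.
  have h1 : A.transpose * (Matrix.gram ℝ v * A) = 1 := by
    rw [← Matrix.gram_eq_one_iff_orthonormal.2 hw]
    ext i j
    simp only [Matrix.mul_apply, Matrix.transpose_apply, Matrix.gram_apply, hA, sum_inner,
      inner_sum, inner_smul_left, inner_smul_right, Finset.mul_sum]
    rw [Finset.sum_comm]
    refine Finset.sum_congr rfl fun k _ => Finset.sum_congr rfl fun l _ => ?_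
    simp only [conj_trivial]
    ring
  have h2 : Matrix.gram ℝ v * (A * A.transpose) = 1 := by
    rw [← Matrix.mul_assoc, mul_eq_one_comm]
    exact h1
  have hB : ∀ k, B (w k) (w k) = ∑ i, ∑ j, A i k * A j k * B (v j) (v i) := by
    intro k
    simp only [hA, map_sum, map_smul, sum_apply, smul_apply, smul_eq_mul, Finset.mul_sum]
    refine Finset.sum_congr rfl fun i _ => Finset.sum_congr rfl fun j _ => ?_
    ring
  rw [Matrix.inv_eq_right_inv h2, Finset.sum_congr rfl fun k _ => hB k]
  refine (Finset.sum_congr rfl fun i _ => ?_).trans Finset.sum_comm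
  refine (Finset.sum_congr rfl fun j _ => ?_).trans Finset.sum_comm
  rw [Matrix.mul_apply, Finset.sum_mul]
  rfl

end SecondOrder

/-! ### The self-shrinker equation for a graph. -/

section Shrinkers

/-- The gradient of `x ↦ ⟪e, x⟫ - u (P x)`, a normal field to the graph of `u` in direction `e`. -/
noncomputable def graphNormal {E : Type*} [NormedAddCommGroup E] [InnerProductSpace ℝ E]
    [CompleteSpace E] {e : E} (u : (ℝ ∙ e)ᗮ → ℝ) (x : E) : E :=
  (InnerProductSpace.toDual ℝ E).symm (innerSL ℝ e - fderiv ℝ u (projPerp e x) ∘L projPerp e)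

section
variable {E : Type*} [NormedAddCommGroup E] [InnerProductSpace ℝ E] [CompleteSpace E] {e : E}
  {u : (ℝ ∙ e)ᗮ → ℝ}

theorem inner_graphNormal (x y : E) :
    ⟪graphNormal u x, y⟫ = ⟪e, y⟫ - fderiv ℝ u (projPerp e x) (projPerp e y) := by
  rw [graphNormal, InnerProductSpace.toDual_symm_apply]
  rfl

theorem graphNormal_ne_zero (he : ‖e‖ = 1) (x : E) : graphNormal u x ≠ 0 := by
  intro h
  have := inner_graphNormal (u := u) x e
  rw [h, inner_zero_left, projPerp_self, map_zero, inner_self_unit he] at this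
  norm_num at this

theorem contDiffAt_graphNormal {W : Set (ℝ ∙ e)ᗮ} (hW : IsOpen W) (hu : ContDiffOn ℝ ∞ u W)
    {x : E} (hx : projPerp e x ∈ W) : ContDiffAt ℝ ∞ (graphNormal u) x := by
  have h1 : ContDiffAt ℝ ∞ (fderiv ℝ u) (projPerp e x) :=
    (hu.contDiffAt (hW.mem_nhds hx)).fderiv_right (by simp)
  have h2 : ContDiffAt ℝ ∞ (fun y => fderiv ℝ u (projPerp e y)) x :=
    h1.comp x (projPerp e).contDiff.contDiffAt
  exact (InnerProductSpace.toDual ℝ E).symm.contDiff.contDiffAt.comp x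
    (contDiffAt_const.sub (h2.clm_comp contDiffAt_const))

/-- Differentiating the normalizing factor yields only a multiple of the normal, which is orthogonal
to `τ`. What remains is the derivative of `⟪e, τ⟫ - Du(P x)(P τ)`, a Hessian term. -/
theorem inner_fderiv_unit_graphNormal (he : ‖e‖ = 1) {W : Set (ℝ ∙ e)ᗮ} (hW : IsOpen W)
    (hu : ContDiffOn ℝ ∞ u W) {x : E} (hx : projPerp e x ∈ W) {τ : E}
    (hτ : ⟪graphNormal u x, τ⟫ = 0) (y : E) :
    ⟪fderiv ℝ (fun x => ‖graphNormal u x‖⁻¹ • graphNormal u x) x y, τ⟫ =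
      -(‖graphNormal u x‖⁻¹ *
        fderiv ℝ (fderiv ℝ u) (projPerp e x) (projPerp e y) (projPerp e τ)) := by
  have hs := contDiffAt_graphNormal hW hu hx
  have hd := hs.differentiableAt (by simp)
  have hn0 := graphNormal_ne_zero (u := u) he x
  have hc : DifferentiableAt ℝ (fun x => ‖graphNormal u x‖⁻¹) x :=
    (hd.norm ℝ hn0).inv (norm_ne_zero_iff.2 hn0)
  have h1 := hc.hasFDerivAt.smul hd.hasFDerivAt
  have hD : ⟪fderiv ℝ (graphNormal u) x y, τ⟫ =
      -(fderiv ℝ (fderiv ℝ u) (projPerp e x) (projPerp e y) (projPerp e τ)) := by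
    have h2 : HasFDerivAt (fun x => ⟪graphNormal u x, τ⟫)
        ((innerSL ℝ τ) ∘L fderiv ℝ (graphNormal u) x) x := by
      simp only [real_inner_comm τ]
      exact (innerSL ℝ τ).hasFDerivAt.comp x hd.hasFDerivAt
    have h3 : HasFDerivAt (fderiv ℝ u) (fderiv ℝ (fderiv ℝ u) (projPerp e x)) (projPerp e x) :=
      (((hu.contDiffAt (hW.mem_nhds hx)).fderiv_right (m := ∞) (by simp)).differentiableAt
        (by simp)).hasFDerivAt
    have h4 : HasFDerivAt (fun y => fderiv ℝ u (projPerp e y))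
        (fderiv ℝ (fderiv ℝ u) (projPerp e x) ∘L projPerp e) x :=
      HasFDerivAt.comp x (g := fderiv ℝ u) h3 (projPerp e).hasFDerivAt
    have h5 := (h4.clm_apply (hasFDerivAt_const (projPerp e τ) x)).const_sub ⟪e, τ⟫
    simp only [inner_graphNormal] at h2
    have := congrArg (fun l : E →L[ℝ] ℝ => l y) (h2.unique h5)
    simp at this
    rw [real_inner_comm]
    exact this
  refine (congrArg (fun l : E →L[ℝ] E => ⟪l y, τ⟫) h1.fderiv).trans ?_
  simp only [add_apply, smul_apply, ContinuousLinearMap.smulRight_apply, inner_add_left,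
    inner_smul_left, hD, hτ, conj_trivial]
  ring

end

variable {d : ℕ} {M : Type*} [TopologicalSpace M] [ChartedSpace (Euc d) M]

theorem partialDeriv_eq_diffAt {k : ℕ} (F : M → Euc k) (p : M) (i : Fin d) :
    partialDeriv F p i = diffAt (d := d) F p (EuclideanSpace.single i (1 : ℝ)) := rfl

/-- The trace over the tangent space does not depend on the frame. -/
theorem sum_firstFundamentalForm_inv {k : ℕ} {F : M → Euc k} {p : M} {w : Fin d → Euc k}
    (hw : Orthonormal ℝ w) (hwp : ∀ j, w j ∈ (diffAt (d := d) F p).range)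
    (B : Euc k →L[ℝ] Euc k →L[ℝ] ℝ) :
    ∑ i, ∑ j, (firstFundamentalForm (d := d) F p)⁻¹ i j *
      B (partialDeriv (d := d) F p j) (partialDeriv (d := d) F p i) = ∑ k, B (w k) (w k) := by
  choose a ha using hwp
  refine sum_gram_inv_eq_sum_orthonormal (v := fun i => partialDeriv (d := d) F p i) hw
    (Matrix.of fun k j => a j k) (fun j => ?_) B
  have h1 : a j = ∑ k, a j k • EuclideanSpace.single k (1 : ℝ) := by
    ext l
    simp [Finset.sum_apply, Pi.single_apply]
  rw [← ha j]
  conv_lhs => rw [h1]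
  refine (map_sum (diffAt (d := d) F p) _ _).trans (Finset.sum_congr rfl fun k _ => ?_)
  rw [map_smul]
  rfl

/-- The self-shrinker equation at a point where the hypersurface is the graph of `u` in
direction `e`. -/
theorem IsSelfShrinker.sum_hessian {F : M → Euc (d + 1)} (hs : IsSelfShrinker (d := d) F)
    (hF : IsSmoothImmersion (d := d) F) {p : M} {e : Euc (d + 1)} (he : ‖e‖ = 1)
    {u : (ℝ ∙ e)ᗮ → ℝ} {W : Set (ℝ ∙ e)ᗮ} (hW : IsOpen W) (hpW : projPerp e (F p) ∈ W)
    (hu : ContDiffOn ℝ ∞ u W) (hg : ∀ᶠ p' in 𝓝 p, ⟪e, F p'⟫ = u (projPerp e (F p'))) :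
    ∑ i, ∑ j, (firstFundamentalForm (d := d) F p)⁻¹ i j *
      fderiv ℝ (fderiv ℝ u) (projPerp e (F p)) (projPerp e (partialDeriv (d := d) F p j))
        (projPerp e (partialDeriv (d := d) F p i)) =
      -((⟪e, F p⟫ - fderiv ℝ u (projPerp e (F p)) (projPerp e (F p))) / 2) := by
  obtain ⟨G, hG, hGo, hpG⟩ := eventually_nhds_iff.1 hg
  set N : Euc (d + 1) → Euc (d + 1) := fun x => ‖graphNormal u x‖⁻¹ • graphNormal u x with hN
  have hPc : Continuous fun p => projPerp e (F p) := (projPerp e).continuous.comp hF.1.continuous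
  set U : Set M := G ∩ (fun p => projPerp e (F p)) ⁻¹' W
  have hU : IsOpen U := hGo.inter (hW.preimage hPc)
  have hpU : p ∈ U := ⟨hpG, hpW⟩
  have hNs : ∀ x, projPerp e x ∈ W → ContDiffAt ℝ ∞ N x := fun x hx => by
    have h1 := contDiffAt_graphNormal hW hu hx
    have h0 := graphNormal_ne_zero (u := u) he x
    exact ((h1.norm ℝ h0).inv (norm_ne_zero_iff.2 h0)).smul h1
  have horth : ∀ q ∈ U, ∀ i, ⟪graphNormal u (F q), partialDeriv (d := d) F q i⟫ = 0 := by
    intro q hq i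
    rw [inner_graphNormal, partialDeriv_eq_diffAt, sub_eq_zero]
    exact inner_diffAt_of_graph (hF.1.mdifferentiable (by simp) q)
      ((hu.contDiffAt (hW.mem_nhds hq.2)).differentiableAt (by simp))
      (eventually_of_mem (hGo.mem_nhds hq.1) hG) _
  have hunit : IsUnitNormalOn (d := d) F (N ∘ F) U := by
    refine ⟨fun q hq => ?_, fun q hq => ⟨?_, fun i => ?_⟩⟩
    · exact ((hNs (F q) hq.2).contMDiffAt.comp q hF.1.contMDiffAt).contMDiffWithinAt
    · exact norm_smul_inv_norm (𝕜 := ℝ) (graphNormal_ne_zero (u := u) he (F q))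
    · change ⟪_, ‖graphNormal u (F q)‖⁻¹ • graphNormal u (F q)⟫ = 0
      rw [inner_smul_right, real_inner_comm, horth q hq i, mul_zero]
  have key := hs U (N ∘ F) hU hunit p hpU
  have hpart : ∀ j, partialDeriv (d := d) (N ∘ F) p j =
      fderiv ℝ N (F p) (partialDeriv (d := d) F p j) := by
    intro j
    have h1 : MDifferentiableAt 𝓘(ℝ, Euc (d + 1)) 𝓘(ℝ, Euc (d + 1)) N (F p) :=
      ((hNs (F p) hpW).differentiableAt (by simp)).mdifferentiableAt
    have := mfderiv_comp p h1 (hF.1.mdifferentiable (by simp) p)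
    rw [mfderiv_eq_fderiv] at this
    exact congrArg (fun l : Euc d →L[ℝ] Euc (d + 1) => l (EuclideanSpace.single j (1 : ℝ))) this
  have hc0 : (0 : ℝ) < ‖graphNormal u (F p)‖⁻¹ :=
    inv_pos.2 (norm_pos_iff.2 (graphNormal_ne_zero (u := u) he (F p)))
  rw [surfaceDivergence] at key
  simp only [hpart] at key
  have hterm : ∀ i j, ⟪fderiv ℝ N (F p) (partialDeriv (d := d) F p j),
      partialDeriv (d := d) F p i⟫ = -(‖graphNormal u (F p)‖⁻¹ *
        fderiv ℝ (fderiv ℝ u) (projPerp e (F p)) (projPerp e (partialDeriv (d := d) F p j))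
        (projPerp e (partialDeriv (d := d) F p i))) := fun i j =>
    inner_fderiv_unit_graphNormal he hW hu hpW (horth p hpU i) _
  simp only [hterm] at key
  have hrhs : ⟪F p, (N ∘ F) p⟫ = ‖graphNormal u (F p)‖⁻¹ *
      (⟪e, F p⟫ - fderiv ℝ u (projPerp e (F p)) (projPerp e (F p))) := by
    change ⟪F p, ‖graphNormal u (F p)‖⁻¹ • graphNormal u (F p)⟫ = _
    rw [inner_smul_right, real_inner_comm, inner_graphNormal]
  rw [hrhs] at key
  -- Both sides of the shrinker equation carry the normalizing factor of the unit normal, so it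
  -- cancels and the equation becomes linear in `u` once the metric is fixed.
  apply mul_left_cancel₀ hc0.ne'
  have e1 : ∀ S : ℝ, ‖graphNormal u (F p)‖⁻¹ * -(S / 2) = -(‖graphNormal u (F p)‖⁻¹ * S / 2) :=
    fun S => by ring
  rw [e1, ← key, Finset.mul_sum, ← Finset.sum_neg_distrib]
  refine Finset.sum_congr rfl fun i _ => ?_
  rw [Finset.mul_sum, ← Finset.sum_neg_distrib]
  refine Finset.sum_congr rfl fun j _ => ?_
  ring

end Shrinkers

/-! ### Comparison of two sheets at the least gap. -/

section Comparison

variable {d : ℕ} {M : Type*} [TopologicalSpace M] [ChartedSpace (Euc d) M]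
  [IsManifold (𝓡 d) ∞ M]

/-- If the tangent spaces at `p` and `q` are transverse, then the differences of points near `p`
and points near `q` fill a neighbourhood of `F p - F q`. -/
theorem image_sub_mem_nhds_of_sup_eq_top {k : ℕ} {F : M → Euc k}
    (hF : ContMDiff (𝓡 d) 𝓘(ℝ, Euc k) ∞ F) {p q : M}
    (hpq : (diffAt (d := d) F p).range ⊔ (diffAt (d := d) F q).range = ⊤) {N : Set (M × M)}
    (hN : N ∈ 𝓝 (p, q)) : (fun x : M × M => F x.1 - F x.2) '' N ∈ 𝓝 (F p - F q) := by
  set φ := extChartAt (𝓡 d) p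
  set ψ := extChartAt (𝓡 d) q
  have aux : ∀ p : M, HasStrictFDerivAt (F ∘ (extChartAt (𝓡 d) p).symm) (diffAt (d := d) F p)
      (extChartAt (𝓡 d) p p) := fun p =>
    ((contDiffOn_comp_extChartAt_symm hF p).contDiffAt
      ((isOpen_extChartAt_target p).mem_nhds (mem_extChartAt_target p))).hasStrictFDerivAt'
      (hasFDerivAt_comp_extChartAt_symm (hF.mdifferentiable (by simp) p)) (by simp)
  let G : Euc d × Euc d → Euc k := fun x => (F ∘ φ.symm) x.1 - (F ∘ ψ.symm) x.2
  have hG : HasStrictFDerivAt G (diffAt (d := d) F p ∘L ContinuousLinearMap.fst ℝ _ _ -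
      diffAt (d := d) F q ∘L ContinuousLinearMap.snd ℝ _ _) (φ p, ψ q) :=
    (HasStrictFDerivAt.comp (φ p, ψ q) (aux p) hasStrictFDerivAt_fst).sub
      (HasStrictFDerivAt.comp (φ p, ψ q) (aux q) hasStrictFDerivAt_snd)
  have hmap := hG.map_nhds_eq_of_surj (by
    rw [eq_top_iff, ← hpq]
    refine sup_le ?_ ?_
    · rintro _ ⟨v, rfl⟩
      exact ⟨(v, 0), by simp⟩
    · rintro _ ⟨v, rfl⟩
      exact ⟨(0, -v), by simp⟩)
  have hGpq : G (φ p, ψ q) = F p - F q := by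
    change F (φ.symm (φ p)) - F (ψ.symm (ψ q)) = _
    rw [extChartAt_to_inv, extChartAt_to_inv]
  rw [hGpq] at hmap
  have hN' : {x : Euc d × Euc d | (φ.symm x.1, ψ.symm x.2) ∈ N} ∈ 𝓝 (φ p, ψ q) := by
    have c1 : Tendsto φ.symm (𝓝 (φ p)) (𝓝 p) := by
      have := continuousAt_extChartAt_symm (I := 𝓡 d) p
      rwa [ContinuousAt, extChartAt_to_inv] at this
    have c2 : Tendsto ψ.symm (𝓝 (ψ q)) (𝓝 q) := by
      have := continuousAt_extChartAt_symm (I := 𝓡 d) q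
      rwa [ContinuousAt, extChartAt_to_inv] at this
    exact (c1.prodMap_nhds c2).eventually hN
  rw [← hmap]
  refine mem_map.2 (mem_of_superset hN' fun x hx => ?_)
  exact ⟨_, hx, rfl⟩

/-- A self-shrinker has no pair of sheets, one above the other in direction `e`, at which the
height difference has a positive local minimum, unless `e` is a bitangent direction. -/
theorem IsSelfShrinker.isBitangent_of_min {F : M → Euc (d + 1)}
    (hs : IsSelfShrinker (d := d) F) (hF : IsSmoothImmersion (d := d) F) {e : Euc (d + 1)}
    (he : ‖e‖ = 1) {Sp Sm : Set (Euc (d + 1))} {p q : M} {s : ℝ} (hs0 : 0 < s)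
    (hpq : F p = F q + s • e)
    (hp : ∀ᶠ x in 𝓝 (F p), x ∈ range F → x ∈ Sm) (hq : ∀ᶠ y in 𝓝 (F q), y ∈ range F → y ∈ Sp)
    (hmin : ∀ y ∈ Sp, ∀ t, 0 < t → y + t • e ∈ Sm → s ≤ t) : IsBitangent F e p q := by
  have hsub : F p - F q = s • e := by rw [hpq, add_sub_cancel_left]
  -- Transverse sheets would realize `t • e` for `t` slightly below `s` as a difference of nearby
  -- points, contradicting minimality.
  have hTne : (diffAt (d := d) F p).range ⊔ (diffAt (d := d) F q).range ≠ ⊤ := by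
    intro htop
    have hN : ∀ᶠ x : M × M in 𝓝 (p, q), F x.1 ∈ Sm ∧ F x.2 ∈ Sp := by
      have h1 : ∀ᶠ p' in 𝓝 p, F p' ∈ Sm :=
        (hF.1.continuous.continuousAt.eventually hp).mono fun p' h => h ⟨p', rfl⟩
      have h2 : ∀ᶠ q' in 𝓝 q, F q' ∈ Sp :=
        (hF.1.continuous.continuousAt.eventually hq).mono fun q' h => h ⟨q', rfl⟩
      exact (continuous_fst.tendsto (p, q) |>.eventually h1).and
        (continuous_snd.tendsto (p, q) |>.eventually h2)
    have himg := image_sub_mem_nhds_of_sup_eq_top hF.1 htop hN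
    rw [hsub] at himg
    have hcont : Tendsto (fun t : ℝ => t • e) (𝓝[<] s) (𝓝 (s • e)) :=
      ((continuous_id.smul continuous_const).tendsto s).mono_left nhdsWithin_le_nhds
    have hpos : ∀ᶠ t in 𝓝[<] s, 0 < t := nhdsWithin_le_nhds (lt_mem_nhds hs0)
    obtain ⟨t, ⟨⟨p', q'⟩, ⟨hp', hq'⟩, ht⟩, ht0, hts⟩ :=
      ((hcont.eventually himg).and (hpos.and self_mem_nhdsWithin)).exists
    have hts : t < s := hts
    have := hmin _ hq' t ht0 (by
      rw [← ht]
      simpa using hp')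
    linarith
  have hTeq : (diffAt (d := d) F p).range = (diffAt (d := d) F q).range := by
    have hlt := Submodule.finrank_lt hTne
    have hle : Module.finrank ℝ ↥((diffAt (d := d) F p).range ⊔ (diffAt (d := d) F q).range) ≤ d := by
      simp at hlt
      omega
    exact (Submodule.eq_of_le_of_finrank_le le_sup_left (by rwa [finrank_range_diffAt hF])).trans
      (Submodule.eq_of_le_of_finrank_le le_sup_right (by rwa [finrank_range_diffAt hF])).symm
  refine ⟨⟨s, hs0, hsub⟩, hTeq, ?_⟩
  by_contra hep
  have heq : e ∉ (diffAt (d := d) F q).range := hTeq ▸ hep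
  obtain ⟨u₁, W₁, hW₁, hp₁, hs₁, hr₁, hg₁⟩ := exists_graph hF he hep
  obtain ⟨u₂, W₂, hW₂, hp₂, hs₂, hr₂, hg₂⟩ := exists_graph hF he heq
  have hP : projPerp e (F p) = projPerp e (F q) := by
    rw [hpq, map_add, map_smul, projPerp_self, smul_zero, add_zero]
  have E₁ := hs.sum_hessian hF he hW₁ hp₁ hs₁ hg₁
  have E₂ := hs.sum_hessian hF he hW₂ hp₂ hs₂ hg₂
  have v₁ := hg₁.self_of_nhds
  have v₂ := hg₂.self_of_nhds
  rw [hP] at hp₁ hr₁ E₁ v₁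
  set z := projPerp e (F q) with hz
  have c₁ : ContDiffAt ℝ ∞ u₁ z := hs₁.contDiffAt (hW₁.mem_nhds hp₁)
  have c₂ : ContDiffAt ℝ ∞ u₂ z := hs₂.contDiffAt (hW₂.mem_nhds hp₂)
  have hval : u₁ z - u₂ z = s := by
    rw [← v₁, ← v₂, ← inner_sub_right, hsub, inner_smul_right, inner_self_unit he, mul_one]
  have hloc : IsLocalMin (fun y => u₁ y - u₂ y) z := by
    have hpos : ∀ᶠ y in 𝓝 z, 0 < u₁ y - u₂ y :=
      (c₁.continuousAt.sub c₂.continuousAt).eventually_const_lt (hs0.trans_eq hval.symm)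
    have m₁ : ∀ᶠ y : (ℝ ∙ e)ᗮ in 𝓝 z, (y : Euc (d + 1)) + u₁ y • e ∈ Sm := by
      filter_upwards [hr₁ _ (hF.1.continuous.continuousAt.eventually hp)] with y hy
      obtain ⟨p', hp', h⟩ := hy
      exact h ▸ hp' ⟨p', rfl⟩
    have m₂ : ∀ᶠ y : (ℝ ∙ e)ᗮ in 𝓝 z, (y : Euc (d + 1)) + u₂ y • e ∈ Sp := by
      filter_upwards [hr₂ _ (hF.1.continuous.continuousAt.eventually hq)] with y hy
      obtain ⟨p', hp', h⟩ := hy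
      exact h ▸ hp' ⟨p', rfl⟩
    filter_upwards [hpos, m₁, m₂] with y h0 h1 h2
    rw [hval]
    refine hmin _ h2 _ h0 ?_
    rwa [add_assoc, ← add_smul, add_sub_cancel]
  have hD : fderiv ℝ u₁ z = fderiv ℝ u₂ z := by
    have := hloc.fderiv_eq_zero
    rwa [fderiv_fun_sub (c₁.differentiableAt (by simp)) (c₂.differentiableAt (by simp)),
      sub_eq_zero] at this
  have hH : ∀ a, 0 ≤ fderiv ℝ (fderiv ℝ u₁) z a a - fderiv ℝ (fderiv ℝ u₂) z a a := by
    intro a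
    have h0 := hloc.fderiv_fderiv_nonneg ((c₁.sub c₂).of_le (m := 2) (WithTop.coe_le_coe.2 le_top)) a
    have hev : fderiv ℝ (fun y => u₁ y - u₂ y) =ᶠ[𝓝 z] fun y => fderiv ℝ u₁ y - fderiv ℝ u₂ y := by
      filter_upwards [hW₁.mem_nhds hp₁, hW₂.mem_nhds hp₂] with y h1 h2
      exact fderiv_fun_sub ((hs₁.contDiffAt (hW₁.mem_nhds h1)).differentiableAt (by simp))
        ((hs₂.contDiffAt (hW₂.mem_nhds h2)).differentiableAt (by simp))
    rw [hev.fderiv_eq, fderiv_fun_sub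
      ((c₁.fderiv_right (m := ∞) (by simp)).differentiableAt (by simp))
      ((c₂.fderiv_right (m := ∞) (by simp)).differentiableAt (by simp))] at h0
    exact h0
  -- The chart frames at `p` and `q` are unrelated; one orthonormal basis of the common tangent
  -- space lets both traces be compared term by term.
  let b := (stdOrthonormalBasis ℝ (diffAt (d := d) F p).range).reindex
    (finCongr (finrank_range_diffAt hF p))
  let w : Fin d → Euc (d + 1) := fun j => b j
  have hw : Orthonormal ℝ w := b.orthonormal.comp_linearIsometry (Submodule.subtypeₗᵢ _)
  have hwp : ∀ j, w j ∈ (diffAt (d := d) F p).range := fun j => (b j).2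
  let B : ((ℝ ∙ e)ᗮ → ℝ) → Euc (d + 1) →L[ℝ] Euc (d + 1) →L[ℝ] ℝ := fun u =>
    (fderiv ℝ (fderiv ℝ u) z).bilinearComp (projPerp e) (projPerp e)
  have T₁ := sum_firstFundamentalForm_inv hw hwp (B u₁)
  have T₂ := sum_firstFundamentalForm_inv hw (fun j => hTeq ▸ hwp j) (B u₂)
  simp only [B, ContinuousLinearMap.bilinearComp_apply] at T₁ T₂
  have hge : 0 ≤ ∑ j, (fderiv ℝ (fderiv ℝ u₁) z (projPerp e (w j)) (projPerp e (w j)) -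
      fderiv ℝ (fderiv ℝ u₂) z (projPerp e (w j)) (projPerp e (w j))) :=
    Finset.sum_nonneg fun j _ => hH _
  -- The gradient terms cancel and the trace of the Hessian difference becomes `-(u₁ z - u₂ z) / 2 =
  -- -s / 2 < 0`.
  rw [Finset.sum_sub_distrib, ← T₁, ← T₂, E₁, E₂, v₁, v₂, hD] at hge
  linarith

end Comparison

/-- Here the hypersurface has dimension `n = m + 1 ≥ 1`; it is the image `𝒮 = range F` of a proper
smooth immersion `F` of a manifold without boundary, and is therefore complete. -/
theorem mainTheorem6 {m : ℕ} {M : Type*} [TopologicalSpace M] [T2Space M]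
    [SecondCountableTopology M] [ChartedSpace (Euc (m + 1)) M] [IsManifold (𝓡 (m + 1)) ∞ M]
    (F : M → Euc (m + 1 + 1)) (hF : IsSmoothImmersion (d := m + 1) F) (hproper : IsProperMap F)
    (δ : ℝ) (hδ : 0 < δ) (hsep : HasSeparatedEnds δ (range F))
    (α : Metric.sphere (0 : Euc (m + 1)) 1 → Euc (m + 1 + 1))
    (hα : IsSmoothImmersion (d := m) α) (hα_emb : IsEmbedding α) (hα_mem : range α ⊆ range F)
    (Sp Sm : Set (Euc (m + 1 + 1))) (hne : Sp ≠ Sm)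
    (hcomp : componentsOf (range F \ range α) = {Sp, Sm})
    (A : Set (Metric.sphere (0 : Euc (m + 1 + 1)) 1))
    (hA : (volume : Measure (Euc (m + 1 + 1))).toSphere A ≠ 0)
    (hord : ∀ b : OrthonormalBasis (Fin (m + 1 + 1)) ℝ (Euc (m + 1 + 1)),
      (∃ e ∈ A, b (Fin.last (m + 1)) = e) → GraphOrdering b (range α) Sp Sm) :
    ¬ IsSelfShrinker F := by
  intro hs
  obtain ⟨e, heA, he⟩ : ∃ e ∈ A, ¬ ∃ p q, IsBitangent F e p q := by
    by_contra! h
    exact hA (measure_mono_null (fun e he => h e he) (toSphere_bitangent hF))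
  have hen : ‖(e : Euc (m + 1 + 1))‖ = 1 := by simp
  have hdim : dimH (range α) < (m + 1 : ℕ) :=
    (dimH_range_le_of_contMDiff (d := m) hα.1).trans_lt (by exact_mod_cast Nat.lt_succ_self m)
  have hS : IsSeparation (range F) (range α) Sp Sm :=
    IsSeparation.of_componentsOf hproper.isClosedMap.isClosed_range
      (isCompact_range hα.1.continuous) (range_subset_closure_sdiff hF hdim) hne hcomp
  obtain ⟨b, hb⟩ := exists_orthonormalBasis_last hen
  obtain ⟨y, hy, s, hs0, hys, hmin⟩ := (hord b ⟨e, heA, hb⟩).exists_min_height b hS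
    (hsep.norm_le_of_norm_sub_le hδ hS)
  rw [hb] at hys
  simp only [hb] at hmin
  obtain ⟨q, rfl⟩ := (hS.left_subset hy).1
  obtain ⟨p, hp⟩ := (hS.symm.left_subset hys).1
  exact he ⟨p, q, hs.isBitangent_of_min hF hen hs0 hp
    (hS.symm.eventually_mem_left (hp ▸ hys)) (hS.eventually_mem_left hy) hmin⟩
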